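/- **Theorem.** All vectors carry the Euclidean norm. Consider a leader $$\dot v=\phi(v)\,\omega,\qquad q_{N+1}=Ev,\qquad v\in\mathbb R^m,\ \omega\in\mathbb R^l,\ q_{N+1}\in\mathbb R^n,$$ where $\phi:\mathbb R^m\to\mathbb R^{m\times l}$ is a known $C^2$ function, $E\in\mathbb R^{n\times m}$ is known and $\omega$ is an unknown constant vector. Assume that $\phi(0)\omega=0$ and that for every compact set $\mathbb V_0\subset\mathbb R^m$ there is a compact set $\mathbb V\subset\mathbb R^m$ such that for every $v(0)\in\mathbb V_0$ the motion of the leader exists and satisfies $v(t)\in\mathbb V$ for all $t\ge 0$. The followers $i=1,\dots,N$ are Euler–Lagrange systems $$M_i(q_i)\ddot q_i+C_i(q_i,\dot q_i)\dot q_i+G_i(q_i)=\tau_i,\qquad q_i,\tau_i\in\mathbb R^n,$$ with $C^1$ functions $M_i,C_i,G_i$, such that: (1) $M_i(q)$ is symmetric and $c_1I\le M_i(q)\le c_2I$ for all $q$, with constants $c_1,c_2>0$; (2) $M_i(q)a+C_i(q,\dot q)b+G_i(q)=Y_i(q,\dot q,a,b)\,\theta_i$ for all $q,\dot q,a,b\in\mathbb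 R^n$, with a known $C^1$ regressor $Y_i$, valued in $\mathbb R^{n\times p}$, and an unknown constant vector $\theta_i\in\mathbb R^p$; (3) $\dot M_i(q)-2C_i(q,\dot q)$ is skew-symmetric for all $q,\dot q$, where $\dot M_i(q)$ is the derivative of $M_i$ at $q$ in the direction $\dot q$. The communication digraph $\bar{\mathcal G}$ has the nodes $1,\dots,N+1$, node $N+1$ being the leader; it contains a spanning tree rooted at $N+1$, and its subgraph induced on $\{1,\dots,N\}$ is undirected. Let $\bar{\mathcal N}_i$ be the set of nodes $j$ such that $(j,i)$ is an edge. With $\hat v_{N+1}=v$ and $z_i=\sum_{j\in\bar{\mathcal N}_i}(\hat v_j-\hat v_i)$, each follower runs the observer $$\dot{\hat v}_i=\phi(\hat v_i)\hat\omega_i+\hat\kappa_i\rho_i(z_i)z_i,\qquad \dot{\hat\omega}_i=\mu\,\phi(\hat v_i)^Tz_i,\qquad \dot{\hat\kappa}_i=\rho_i(z_i)\,z_i^Tz_i,$$ and the adaptive control law $$\tau_i=-K_is_i+Y_i\hat\theta_i,\qquad \dot{\hat\theta}_i=-\Gamma_iY_i^Ts_i,$$ where $s_i=\dot q_i-r_i$,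 $\;r_i=E\phi(\hat v_i)\hat\omega_i-\alpha(q_i-E\hat v_i)$, $\;Y_i=Y_i(q_i,\dot q_i,a_i,r_i)$, and $$a_i=E\phi(\hat v_i)\dot{\hat\omega}_i+E\big(D\phi(\hat v_i)[\dot{\hat v}_i]\big)\hat\omega_i-\alpha(\dot q_i-E\dot{\hat v}_i)$$ (the time derivative of $r_i$ along the motion), with $\dot{\hat v}_i,\dot{\hat\omega}_i$ given by the observer equations. Then there are smooth functions $\rho_i:\mathbb R^m\to[1,\infty)$, $i=1,\dots,N$, which do not depend on the unknown parameters $\omega,\theta_i$, on the followers, on the graph or on the initial conditions, such that the following holds for all such $\omega$, graphs and followers, for all $\mu>0$, $\alpha>0$, all positive definite matrices $K_i$, all diagonal matrices $\Gamma_i$ with positive diagonal entries, and every compact set $\mathbb V_0\subset\mathbb R^m$ containing the origin. For all initial conditions with $v(0)\in\mathbb V_0$ and with $q_i(0),\dot q_i(0)\in\mathbb R^n$, $\hat v_i(0)\in\mathbb R^m$, $\hat\omega_i(0)\in\mathbb R^l$, $\hat\kappa_i(0)\in\mathbb R$, $\hat\theta_i(0)\in\mathbb R^p$ arbitrary, the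 closed loop has a solution on $[0,\infty)$, and every such solution satisfies, for $i=1,\dots,N$: $q_i(t)$ and $\dot q_i(t)$ are bounded on $[0,\infty)$, and $$\lim_{t\to\infty}\big(q_i(t)-q_{N+1}(t)\big)=0.$$ -/

import Mathlib

open Set Filter Topology

noncomputable section

/-- `ℝᵏ` with the Euclidean norm. Real `r × k` matrices are represented as continuous linear maps
`Vec k →L[ℝ] Vec r`, the transpose being the adjoint. -/
abbrev Vec (k : ℕ) : Type := EuclideanSpace ℝ (Fin k)

/-! ### Communication graph

The node set of a network with `N` followers is `Option (Fin N)`: `some i` is a follower and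
`none` is the leader. `G.Adj j i` says that `(j, i)` is an edge, i.e. node `i` receives
information from node `j`. -/

/-- `G` contains a directed spanning tree with root `r`: a subgraph on all the nodes in which the
root has no parent, every other node has exactly one parent, and every node is reached from the
root along a directed path. -/
def ContainsSpanningTree {V : Type*} (G : Digraph V) (r : V) : Prop :=
  ∃ T : Digraph V, (∀ u w, T.Adj u w → G.Adj u w) ∧ (∀ u, ¬ T.Adj u r) ∧
    (∀ w, w ≠ r → ∃! u, T.Adj u w) ∧ ∀ w, Relation.ReflTransGen T.Adj r w

/-- The subgraph induced on the followers is undirected, and the graph contains a spanning tree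
rooted at the leader. -/
structure IsLeaderFollowingGraph {N : ℕ} (G : Digraph (Option (Fin N))) : Prop where
  undirected : ∀ i j : Fin N, G.Adj (some i) (some j) → G.Adj (some j) (some i)
  spanningTree : ContainsSpanningTree G none

open Classical in
/-- `z_i = ∑_{j ∈ N_i} (v̂_j - v̂_i)`, where `N_i = {j | (j, i) is an edge}` and the leader's
entry is its true state `v`. -/
def localError {N m : ℕ} (G : Digraph (Option (Fin N))) (v : Vec m) (vh : Fin N → Vec m)
    (i : Fin N) : Vec m :=
  ∑ j : Option (Fin N) with G.Adj j (some i), (j.elim v vh - vh i)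

/-! ### Leader -/

/-- Assumptions on the leader `v' = p(v, ω) = φ(v) ω`: `p(·, ω)` vanishes at the origin, and for
each compact set `V₀` there is a compact set `V₁` such that the motions that start in `V₀`
exist and stay in `V₁` for all `t ≥ 0`. -/
structure LeaderAssumption {m l : ℕ} (φ : Vec m → Vec l →L[ℝ] Vec m) (ω : Vec l) : Prop where
  vanishes : φ 0 ω = 0
  bounded : ∀ V₀ : Set (Vec m), IsCompact V₀ → ∃ V₁ : Set (Vec m), IsCompact V₁ ∧
    ∀ v₀ ∈ V₀, ∃ v : ℝ → Vec m, v 0 = v₀ ∧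
      ∀ t, 0 ≤ t → HasDerivWithinAt v (φ (v t) ω) (Ici 0) t ∧ v t ∈ V₁

/-! ### Followers -/

/-- The data of an Euler-Lagrange system `M(q) q'' + C(q, q') q' + G(q) = τ`, with a regressor
`Y` and a parameter vector `θ`. -/
structure ELSystem (n p : ℕ) where
  M : Vec n → Vec n →L[ℝ] Vec n
  C : Vec n → Vec n → Vec n →L[ℝ] Vec n
  G : Vec n → Vec n
  Y : Vec n → Vec n → Vec n → Vec n → Vec p →L[ℝ] Vec n
  θ : Vec p

/-- The standing properties of an Euler-Lagrange system, together with the regularity of the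
functions that describe it. -/
structure ELSystem.Admissible {n p : ℕ} (S : ELSystem n p) : Prop where
  smooth_M : ContDiff ℝ 1 S.M
  smooth_C : ContDiff ℝ 1 (fun x : Vec n × Vec n => S.C x.1 x.2)
  smooth_G : ContDiff ℝ 1 S.G
  smooth_Y : ContDiff ℝ 1
    (fun x : Vec n × Vec n × Vec n × Vec n => S.Y x.1 x.2.1 x.2.2.1 x.2.2.2)
  /-- `M(q)` is symmetric. -/
  symm : ∀ q x y, inner ℝ (S.M q x) y = inner ℝ x (S.M q y)
  /-- `c₁ I ≤ M(q) ≤ c₂ I` uniformly in `q`. -/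
  bounds : ∃ c₁ c₂ : ℝ, 0 < c₁ ∧ 0 < c₂ ∧ ∀ q x,
    c₁ * ‖x‖ ^ 2 ≤ inner ℝ x (S.M q x) ∧ inner ℝ x (S.M q x) ≤ c₂ * ‖x‖ ^ 2
  /-- Linear parametrization: `M(q) a + C(q, q') b + G(q) = Y(q, q', a, b) θ`. -/
  linear_param : ∀ q dq a b, S.M q a + S.C q dq b + S.G q = S.Y q dq a b S.θ
  /-- `M'(q) - 2 C(q, q')` is skew-symmetric, where `M'(q)` is the derivative of `M` at `q` in
  the direction `q'`. -/
  skew : ∀ q dq x y,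
    inner ℝ ((fderiv ℝ S.M q dq - (2 : ℝ) • S.C q dq) x) y =
      - inner ℝ x ((fderiv ℝ S.M q dq - (2 : ℝ) • S.C q dq) y)

/-! ### Observer and control law -/

/-- Design parameters: the observer functions `ρ_i`, the scalars `μ` and `α`, the matrices `K_i`
and the diagonals `γ_i` of the matrices `Γ_i`. -/
structure Design (N n m p : ℕ) where
  ρ : Fin N → Vec m → ℝ
  μ : ℝ
  α : ℝ
  K : Fin N → Vec n →L[ℝ] Vec n
  γ : Fin N → Fin p → ℝ

/-- The diagonal matrix `Γ_i`. -/
def Design.Γ {N n m p : ℕ} (D : Design N n m p) (i : Fin N) : Vec p →L[ℝ] Vec p :=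
  Matrix.toEuclideanCLM (n := Fin p) (𝕜 := ℝ) (Matrix.diagonal (D.γ i))

/-- `μ > 0`, `α > 0`, the `K_i` are positive definite and the diagonals of the `Γ_i` are
positive. -/
structure Design.PositiveGains {N n m p : ℕ} (D : Design N n m p) : Prop where
  μ_pos : 0 < D.μ
  α_pos : 0 < D.α
  K_pos : ∀ i x, x ≠ 0 → 0 < inner ℝ x (D.K i x)
  γ_pos : ∀ i j, 0 < D.γ i j

/-- A state of the closed loop: the leader state `v`, the observer states `v̂_i`, `ω̂_i`, `κ̂_i`,
the parameter estimates `θ̂_i`, the positions `q_i` and the velocities `q_i'`. -/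
structure LoopState (N n m l p : ℕ) where
  v : Vec m
  vh : Fin N → Vec m
  wh : Fin N → Vec l
  κ : Fin N → ℝ
  θh : Fin N → Vec p
  q : Fin N → Vec n
  dq : Fin N → Vec n

section Law

variable {N n m l p : ℕ} (φ : Vec m → Vec l →L[ℝ] Vec m) (E : Vec m →L[ℝ] Vec n)
  (Gr : Digraph (Option (Fin N))) (D : Design N n m p) (x : LoopState N n m l p) (i : Fin N)

/-- `z_i`. -/
def LoopState.z : Vec m := localError Gr x.v x.vh i

/-- `v̂_i' = φ(v̂_i) ω̂_i + κ̂_i ρ_i(z_i) z_i`. -/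
def vhRate : Vec m :=
  φ (x.vh i) (x.wh i) + (x.κ i * D.ρ i (x.z Gr i)) • x.z Gr i

/-- `ω̂_i' = μ φ(v̂_i)ᵀ z_i`. -/
def whRate : Vec l :=
  D.μ • ContinuousLinearMap.adjoint (φ (x.vh i)) (x.z Gr i)

/-- `κ̂_i' = ρ_i(z_i) z_iᵀ z_i`. -/
def κRate : ℝ := D.ρ i (x.z Gr i) * inner ℝ (x.z Gr i) (x.z Gr i)

/-- The reference velocity `E φ(v̂_i) ω̂_i - α (q_i - E v̂_i)`. -/
def refVel : Vec n :=
  E (φ (x.vh i) (x.wh i)) - D.α • (x.q i - E (x.vh i))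

/-- The time derivative of the reference velocity along the motion, as a function of the state:
`E φ(v̂_i) ω̂_i' + E (Dφ(v̂_i)[v̂_i']) ω̂_i - α (q_i' - E v̂_i')`. -/
def refAcc : Vec n :=
  E (φ (x.vh i) (whRate φ Gr D x i))
    + E (fderiv ℝ φ (x.vh i) (vhRate φ Gr D x i) (x.wh i))
    - D.α • (x.dq i - E (vhRate φ Gr D x i))

/-- `s_i`: the velocity minus the reference velocity. -/
def slidingVar : Vec n := x.dq i - refVel φ E D x i

/-- The regressor matrix used by the controller: `Y_i` at the position, the velocity, the
reference acceleration and the reference velocity. -/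
def regressor (Y : Vec n → Vec n → Vec n → Vec n → Vec p →L[ℝ] Vec n) : Vec p →L[ℝ] Vec n :=
  Y (x.q i) (x.dq i) (refAcc φ E Gr D x i) (refVel φ E D x i)

/-- The control torque `τ_i = -K_i s_i + Y_i θ̂_i`. -/
def torque (Y : Vec n → Vec n → Vec n → Vec n → Vec p →L[ℝ] Vec n) : Vec n :=
  - D.K i (slidingVar φ E D x i) + regressor φ E Gr D x i Y (x.θh i)

/-- `θ̂_i' = -Γ_i Y_iᵀ s_i`. -/
def θhRate (Y : Vec n → Vec n → Vec n → Vec n → Vec p →L[ℝ] Vec n) : Vec p :=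
  - D.Γ i (ContinuousLinearMap.adjoint (regressor φ E Gr D x i Y) (slidingVar φ E D x i))

end Law

/-- `x` is a solution on `[0, ∞)` of the closed loop that consists of the leader, the followers,
the observers and the adaptive control law (derivatives at `0` are one-sided). -/
structure IsClosedLoopSolution {N n m l p : ℕ} (φ : Vec m → Vec l →L[ℝ] Vec m) (ω : Vec l)
    (E : Vec m →L[ℝ] Vec n) (Gr : Digraph (Option (Fin N))) (S : Fin N → ELSystem n p)
    (D : Design N n m p) (x : ℝ → LoopState N n m l p) : Prop where
  leader : ∀ t, 0 ≤ t →
    HasDerivWithinAt (fun r => (x r).v) (φ (x t).v ω) (Ici 0) t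
  observer_v : ∀ i t, 0 ≤ t →
    HasDerivWithinAt (fun r => (x r).vh i) (vhRate φ Gr D (x t) i) (Ici 0) t
  observer_w : ∀ i t, 0 ≤ t →
    HasDerivWithinAt (fun r => (x r).wh i) (whRate φ Gr D (x t) i) (Ici 0) t
  observer_κ : ∀ i t, 0 ≤ t →
    HasDerivWithinAt (fun r => (x r).κ i) (κRate Gr D (x t) i) (Ici 0) t
  adaptation : ∀ i t, 0 ≤ t →
    HasDerivWithinAt (fun r => (x r).θh i) (θhRate φ E Gr D (x t) i (S i).Y) (Ici 0) t
  velocity : ∀ i t, 0 ≤ t →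
    HasDerivWithinAt (fun r => (x r).q i) ((x t).dq i) (Ici 0) t
  dynamics : ∀ i t, 0 ≤ t → ∃ ddq : Vec n,
    HasDerivWithinAt (fun r => (x r).dq i) ddq (Ici 0) t ∧
      (S i).M ((x t).q i) ddq + (S i).C ((x t).q i) ((x t).dq i) ((x t).dq i)
        + (S i).G ((x t).q i) = torque φ E Gr D (x t) i (S i).Y

end

/-!
The closed loop is a cascade: the observers do not depend on the followers, and the followers see
the observers only through a bounded signal and a vanishing one.

*Observers.* Let `u_i = v̂_i - v`. The local errors are `z = -H u`, where `H` is the block of the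
graph Laplacian that belongs to the followers. Since the followers communicate over undirected edges
`H` is symmetric, and since every follower is reached from the leader `H` is positive definite
(`exists_pos_mul_sq_norm_le_energy`). Along a motion, the derivative of
`uᵀHu / 2 + ∑ |ω̂_i - ω|² / (2μ) + ∑ (κ̂_i - k)² / 2` is
`-∑ z_iᵀ(φ(v̂_i) - φ(v))ω - k ∑ ρ_i(z_i)|z_i|²`. The `ρ_i` are chosen as a smooth majorant of a
monotone function built from the local Lipschitz constants of `φ` and from the largest norm of `H⁻¹`
among the finitely many graphs with `N` followers. They then dominate the first sum up to a constant
that depends on `ω` and on the compact set containing the leader (`sum_inner_mismatch_le`), and a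
large comparison gain `k` makes the derivative at most `-|z_i|²`.

*Followers.* For the sliding variable `s_i`, the energy
`s_iᵀM_i s_i / 2 + (θ̂_i - θ_i)ᵀΓ_i⁻¹(θ̂_i - θ_i) / 2` has the derivative `-s_iᵀK_i s_i`, by the linear
parametrization and the skew symmetry of `M_i' - 2C_i`. The tracking error `e_i = q_i - E v̂_i` solves
`e_i' = s_i - α e_i - κ̂_i ρ_i(z_i) E z_i`, a stable linear equation whose inputs are dissipated by the
two energies. Hence a weighted sum of both energies and `|e_i|²` has a derivative of at most
`-(|z_i|² + α|e_i|²)` (`exists_totalEnergy`).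

These functions bound all the states, uniformly over all intervals of existence
(`exists_bound_of_isBoundedLeaderRun`), so that the solution is global
(`exists_global_solution`). Barbalat's lemma (`tendsto_zero_of_dissipation`) gives `z → 0` and
`e_i → 0`; then `u = -H⁻¹z → 0` and `q_i - E v = e_i + E u_i → 0`.
-/

noncomputable section

/-! ### Tools from analysis -/

section Analysis

theorem antitoneOn_of_hasDerivWithinAt_self {J : Set ℝ} (hJ : Convex ℝ J) {f f' : ℝ → ℝ}
    (hf : ∀ t ∈ J, HasDerivWithinAt f (f' t) J t) (hf' : ∀ t ∈ J, f' t ≤ 0) : AntitoneOn f J :=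
  antitoneOn_of_hasDerivWithinAt_nonpos hJ (fun t ht => (hf t ht).continuousWithinAt)
    (fun t ht => (hf t (interior_subset ht)).mono interior_subset)
    (fun t ht => hf' t (interior_subset ht))

/-- A form of Barbalat's lemma: a uniformly continuous dissipation rate `f ≥ 0` of a function `W`
that is bounded below tends to zero. -/
theorem tendsto_zero_of_dissipation {W w f : ℝ → ℝ}
    (hW : ∀ t ∈ Ici (0 : ℝ), HasDerivWithinAt W (w t) (Ici 0) t)
    (hw : ∀ t ∈ Ici (0 : ℝ), w t ≤ - f t) (hW0 : ∀ t ∈ Ici (0 : ℝ), 0 ≤ W t)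
    (hf0 : ∀ t ∈ Ici (0 : ℝ), 0 ≤ f t) (hf : UniformContinuousOn f (Ici 0)) :
    Tendsto f atTop (𝓝 0) := by
  have hanti : AntitoneOn W (Ici 0) := antitoneOn_of_hasDerivWithinAt_self (convex_Ici 0) hW
    fun t ht => (hw t ht).trans (neg_nonpos.2 (hf0 t ht))
  obtain ⟨c, hc⟩ : ∃ c, Tendsto W atTop (𝓝 c) := by
    have hA : Antitone fun t => W (max t 0) := fun a b hab =>
      hanti (mem_Ici.2 (le_max_right _ _)) (mem_Ici.2 (le_max_right _ _)) (max_le_max_right 0 hab)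
    rcases tendsto_atTop_of_antitone hA with h | ⟨c, hc⟩
    · obtain ⟨t, ht⟩ := (h.eventually (eventually_lt_atBot 0)).exists
      exact absurd ht (not_lt.2 (hW0 _ (mem_Ici.2 (le_max_right _ _))))
    · refine ⟨c, hc.congr' ?_⟩
      filter_upwards [eventually_ge_atTop 0] with t ht
      rw [max_eq_left ht]
  rw [Metric.tendsto_atTop]
  intro ε hε
  obtain ⟨δ, hδ, hδf⟩ := Metric.uniformContinuousOn_iff.1 hf (ε / 2) (by positivity)
  have hdiff : Tendsto (fun t => W t - W (t + δ / 2)) atTop (𝓝 (c - c)) :=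
    hc.sub (hc.comp (tendsto_atTop_add_const_right _ _ tendsto_id))
  rw [sub_self] at hdiff
  obtain ⟨T, hT⟩ := eventually_atTop.1
    (hdiff.eventually (gt_mem_nhds (show (0 : ℝ) < δ / 2 * (ε / 2) by positivity)))
  refine ⟨max T 0, fun t ht => ?_⟩
  have ht0 : 0 ≤ t := (le_max_right _ _).trans ht
  rw [Real.dist_eq, sub_zero, abs_of_nonneg (hf0 t ht0)]
  by_contra! hcon
  -- On `[t, t + δ / 2]` the rate exceeds `ε / 2`, so `W` drops by at least `δ / 2 * (ε / 2)`.
  have hsub : Icc t (t + δ / 2) ⊆ Ici 0 := fun r hr => ht0.trans hr.1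
  have h2 : AntitoneOn (fun r => W r + r * (ε / 2)) (Icc t (t + δ / 2)) := by
    refine antitoneOn_of_hasDerivWithinAt_self (convex_Icc _ _)
      (f' := fun r => w r + 1 * (ε / 2)) (fun r hr => ?_) (fun r hr => ?_)
    · exact ((hW r (hsub hr)).mono hsub).add ((hasDerivWithinAt_id r _).mul_const _)
    · have h3 := hδf t ht0 r (hsub hr) (by
        rw [Real.dist_eq, abs_sub_comm, abs_of_nonneg (by linarith [hr.1])]
        linarith [hr.2])
      rw [Real.dist_eq] at h3
      have h4 := (abs_lt.1 h3).2
      have h5 := hw r (hsub hr)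
      linarith
  have h3 := h2 (left_mem_Icc.2 (by linarith)) (right_mem_Icc.2 (by linarith))
    (show t ≤ t + δ / 2 by linarith)
  have h4 := hT t ((le_max_left _ _).trans ht)
  simp only at h3
  linarith

/-- A continuous function that is homogeneous of degree two and positive away from the origin is
bounded below by a multiple of the squared norm. -/
theorem exists_pos_mul_sq_norm_le {V : Type*} [NormedAddCommGroup V] [NormedSpace ℝ V]
    [FiniteDimensional ℝ V] {f : V → ℝ} (hf : Continuous f)
    (hhom : ∀ (c : ℝ) x, f (c • x) = c ^ 2 * f x) (hpos : ∀ x, x ≠ 0 → 0 < f x) :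
    ∃ c : ℝ, 0 < c ∧ ∀ x, c * ‖x‖ ^ 2 ≤ f x := by
  have hf0 : f 0 = 0 := by simpa using hhom 0 0
  rcases (Metric.sphere (0 : V) 1).eq_empty_or_nonempty with he | hne
  · refine ⟨1, one_pos, fun x => ?_⟩
    have hx : x = 0 := by
      by_contra hx
      have : ‖x‖⁻¹ • x ∈ Metric.sphere (0 : V) 1 := by
        simp [norm_smul, inv_mul_cancel₀ (norm_ne_zero_iff.2 hx)]
      simp [he] at this
    simp [hx, hf0]
  · obtain ⟨u, hu, hmin⟩ := (isCompact_sphere (0 : V) 1).exists_isMinOn hne hf.continuousOn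
    have hu0 : u ≠ 0 := by
      rintro rfl
      simp at hu
    refine ⟨f u, hpos u hu0, fun x => ?_⟩
    rcases eq_or_ne x 0 with rfl | hx
    · simp [hf0]
    · have hn : ‖x‖ ≠ 0 := norm_ne_zero_iff.2 hx
      have h1 : f u ≤ f (‖x‖⁻¹ • x) := hmin (by
        simp [norm_smul, inv_mul_cancel₀ hn])
      have h2 : f x = ‖x‖ ^ 2 * f (‖x‖⁻¹ • x) := by
        rw [← hhom, smul_smul, mul_inv_cancel₀ hn, one_smul]
      rw [h2, mul_comm]
      gcongr

/-- A monotone function of the norm has a smooth majorant. -/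
theorem exists_smooth_majorant {V : Type*} [NormedAddCommGroup V] [NormedSpace ℝ V]
    [FiniteDimensional ℝ V] {h : ℝ → ℝ} (hh : Monotone h) :
    ∃ ρ : V → ℝ, ContDiff ℝ ((⊤ : ℕ∞) : WithTop ℕ∞) ρ ∧ ∀ z, h ‖z‖ ≤ ρ z := by
  obtain ⟨ρ, hρ⟩ := exists_contMDiffMap_forall_mem_convex_of_local_const
    (n := ⊤) (modelWithCornersSelf ℝ V) (t := fun z : V => Ici (h ‖z‖)) (fun z => convex_Ici _)
    (fun z => ⟨h (‖z‖ + 1), by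
      filter_upwards [Metric.ball_mem_nhds z one_pos] with y hy
      refine hh ?_
      have := norm_le_norm_add_norm_sub' y z
      rw [mem_ball_iff_norm] at hy
      linarith⟩)
  exact ⟨ρ, ρ.contMDiff.contDiff, hρ⟩

theorem exists_monotone_lipschitz_bound {V W : Type*} [NormedAddCommGroup V] [NormedSpace ℝ V]
    [FiniteDimensional ℝ V] [NormedAddCommGroup W] [NormedSpace ℝ W] {φ : V → W}
    (hφ : ContDiff ℝ 1 φ) :
    ∃ g : ℝ → ℝ, Monotone g ∧ (∀ r, 1 ≤ g r) ∧
      ∀ r x y, ‖x‖ ≤ r → ‖y‖ ≤ r → ‖φ x - φ y‖ ≤ g r * ‖x - y‖ := by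
  have hc : Continuous fun x => ‖fderiv ℝ φ x‖ := (hφ.continuous_fderiv one_ne_zero).norm
  have hcomp : ∀ r, IsCompact (Metric.closedBall (0 : V) r) := fun r => isCompact_closedBall _ _
  have hbdd : ∀ r, BddAbove ((fun x => ‖fderiv ℝ φ x‖) '' Metric.closedBall (0 : V) r) :=
    fun r => ((hcomp r).image hc).bddAbove
  have hnn : ∀ r, 0 ≤ sSup ((fun x => ‖fderiv ℝ φ x‖) '' Metric.closedBall (0 : V) r) :=
    fun r => Real.sSup_nonneg (by rintro _ ⟨x, -, rfl⟩; exact norm_nonneg _)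
  refine ⟨fun r => 1 + sSup ((fun x => ‖fderiv ℝ φ x‖) '' Metric.closedBall (0 : V) r),
    fun r r' hr => ?_, fun r => by linarith [hnn r], fun r x y hx hy => ?_⟩
  · rcases (Metric.closedBall (0 : V) r).eq_empty_or_nonempty with he | hne
    · simp [he, hnn r']
    · exact add_le_add_right (csSup_le_csSup (hbdd r') (hne.image _)
        (image_mono (Metric.closedBall_subset_closedBall hr))) 1
  · refine (convex_closedBall (0 : V) r).norm_image_sub_le_of_norm_fderiv_le
      (fun z _ => (hφ.differentiable one_ne_zero) z) (fun z hz => ?_)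
      (mem_closedBall_zero_iff.2 hy) (mem_closedBall_zero_iff.2 hx)
    have := le_csSup (hbdd r) (mem_image_of_mem _ hz)
    exact this.trans (le_add_of_nonneg_left zero_le_one)

end Analysis

/-! ### Autonomous ordinary differential equations -/

section ODE

variable {V : Type*} [NormedAddCommGroup V] [NormedSpace ℝ V] [FiniteDimensional ℝ V]

theorem eqOn_Icc_of_hasDerivWithinAt {F : V → V} (hF : ContDiff ℝ 1 F) {T : ℝ} {y z : ℝ → V}
    (hy : ∀ t ∈ Icc 0 T, HasDerivWithinAt y (F (y t)) (Icc 0 T) t)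
    (hz : ∀ t ∈ Icc 0 T, HasDerivWithinAt z (F (z t)) (Icc 0 T) t) (h0 : y 0 = z 0) :
    EqOn y z (Icc 0 T) := by
  have hyc : ContinuousOn y (Icc 0 T) := fun t ht => (hy t ht).continuousWithinAt
  have hzc : ContinuousOn z (Icc 0 T) := fun t ht => (hz t ht).continuousWithinAt
  obtain ⟨A, hA⟩ := isCompact_Icc.exists_bound_of_continuousOn hyc
  obtain ⟨B, hB⟩ := isCompact_Icc.exists_bound_of_continuousOn hzc
  obtain ⟨K, hK⟩ := (hF.contDiffOn (s := Metric.closedBall 0 (max A B))).exists_lipschitzOnWith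
    one_ne_zero (convex_closedBall _ _) (isCompact_closedBall _ _)
  have hright : ∀ {f : ℝ → V}, (∀ t ∈ Icc 0 T, HasDerivWithinAt f (F (f t)) (Icc 0 T) t) →
      ∀ t ∈ Ico 0 T, HasDerivWithinAt f (F (f t)) (Ici t) t := fun hf t ht =>
    (hf t (Ico_subset_Icc_self ht)).mono_of_mem_nhdsWithin (Icc_mem_nhdsGE_of_mem ht)
  exact ODE_solution_unique_of_mem_Icc_right (v := fun _ => F)
    (s := fun _ => Metric.closedBall 0 (max A B)) (fun _ _ => hK) hyc (hright hy)
    (fun t ht => mem_closedBall_zero_iff.2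
      ((hA t (Ico_subset_Icc_self ht)).trans (le_max_left _ _))) hzc (hright hz)
    (fun t ht => mem_closedBall_zero_iff.2
      ((hB t (Ico_subset_Icc_self ht)).trans (le_max_right _ _))) h0

theorem exists_solution_Icc_of_hasCompactSupport {F : V → V} (hF : ContDiff ℝ 1 F)
    (hs : HasCompactSupport F) (y₀ : V) {T : ℝ} (hT : 0 ≤ T) :
    ∃ y : ℝ → V, y 0 = y₀ ∧ ∀ t ∈ Icc 0 T, HasDerivWithinAt y (F (y t)) (Icc 0 T) t := by
  obtain ⟨K, hK⟩ := ContDiff.lipschitzWith_of_hasCompactSupport hs hF one_ne_zero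
  obtain ⟨C, hC⟩ := hs.exists_bound_of_continuous hF.continuous
  have hC0 : 0 ≤ C := (norm_nonneg _).trans (hC 0)
  have hP : IsPicardLindelof (fun _ => F) (tmin := 0) (tmax := T) ⟨0, left_mem_Icc.2 hT⟩ y₀
      (⟨C, hC0⟩ * ⟨T, hT⟩) 0 ⟨C, hC0⟩ K :=
    IsPicardLindelof.of_time_independent (fun x _ => hC x) hK.lipschitzOnWith (by
      rw [sub_zero, sub_self, max_eq_left hT, NNReal.coe_zero, sub_zero]
      exact le_rfl)
  exact hP.exists_eq_forall_mem_Icc_hasDerivWithinAt₀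

/-- Solutions of an autonomous equation with a `C¹` right-hand side exist on `[0, ∞)` as soon as
the solutions on bounded intervals obey an a priori bound that does not depend on the interval. The
vector field is multiplied by a cutoff function; by the bound the solutions of the modified
equation never reach the region where the cutoff function differs from one. -/
theorem exists_global_solution {F : V → V} (hF : ContDiff ℝ 1 F) (y₀ : V) (B : ℝ)
    (hB : ∀ T : ℝ, 0 ≤ T → ∀ y : ℝ → V, y 0 = y₀ →
      (∀ t ∈ Icc 0 T, HasDerivWithinAt y (F (y t)) (Icc 0 T) t) → ∀ t ∈ Icc 0 T, ‖y t‖ ≤ B) :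
    ∃ y : ℝ → V, y 0 = y₀ ∧ ∀ t ∈ Ici (0 : ℝ), HasDerivWithinAt y (F (y t)) (Ici 0) t := by
  have h0 : ‖y₀‖ ≤ B := by
    refine hB 0 le_rfl (fun _ => y₀) rfl (fun t ht => ?_) 0 (left_mem_Icc.2 le_rfl)
    rw [Icc_self] at ht ⊢
    rw [mem_singleton_iff.1 ht, hasDerivWithinAt_iff_tendsto_slope]
    simp
  have hB0 : 0 ≤ B := (norm_nonneg _).trans h0
  let χ : ContDiffBump (0 : V) := ⟨B + 1, B + 2, by linarith, by linarith⟩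
  have hχ : ∀ x : V, ‖x‖ ≤ B + 1 → χ x • F x = F x := fun x hx => by
    rw [χ.one_of_mem_closedBall (mem_closedBall_zero_iff.2 hx), one_smul]
  have key : ∀ T : ℝ, 0 ≤ T → ∃ y : ℝ → V, y 0 = y₀ ∧
      ∀ t ∈ Icc 0 T, HasDerivWithinAt y (F (y t)) (Icc 0 T) t := by
    intro T hT
    obtain ⟨y, hy0, hy⟩ := exists_solution_Icc_of_hasCompactSupport
      (F := fun x => χ x • F x) (χ.contDiff.smul hF) χ.hasCompactSupport.smul_right y₀ hT
    have hyc : ContinuousOn (fun t => ‖y t‖) (Icc 0 T) :=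
      fun t ht => (hy t ht).continuousWithinAt.norm
    have hlt : ∀ t ∈ Icc 0 T, ‖y t‖ < B + 1 := by
      by_contra! hcon
      obtain ⟨t, ht, htB⟩ := hcon
      -- `t₁` is the first time at which the solution has norm `B + 1`.
      have hS : IsCompact (Icc 0 T ∩ (fun t => ‖y t‖) ⁻¹' {B + 1}) :=
        isCompact_Icc.of_isClosed_subset (hyc.preimage_isClosed_of_isClosed isClosed_Icc
          isClosed_singleton) inter_subset_left
      have hIVT : ∀ s ∈ Icc 0 T, B + 1 ≤ ‖y s‖ → ∃ r ∈ Icc 0 s, ‖y r‖ = B + 1 := fun s hs hsB =>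
        intermediate_value_Icc hs.1 (hyc.mono (Icc_subset_Icc_right hs.2))
          ⟨by rw [hy0]; linarith, hsB⟩
      obtain ⟨r, hr, hrB⟩ := hIVT t ht htB
      obtain ⟨t₁, ⟨ht₁, ht₁B⟩, hleast⟩ := hS.exists_isLeast
        ⟨r, Icc_subset_Icc_right ht.2 hr, hrB⟩
      have hbefore : ∀ s ∈ Icc 0 t₁, ‖y s‖ ≤ B + 1 := by
        intro s hs
        by_contra! hs'
        obtain ⟨r, hr, hrB⟩ := hIVT s ⟨hs.1, hs.2.trans ht₁.2⟩ hs'.le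
        have h1 : t₁ ≤ r := hleast ⟨⟨hr.1, hr.2.trans (hs.2.trans ht₁.2)⟩, hrB⟩
        have h2 : s = r := le_antisymm (hs.2.trans h1) hr.2
        rw [h2, hrB] at hs'
        exact lt_irrefl _ hs'
      have h1 := hB t₁ ht₁.1 y hy0 (fun s hs => by
        have := (hy s ⟨hs.1, hs.2.trans ht₁.2⟩).mono (Icc_subset_Icc_right ht₁.2)
        rwa [hχ _ (hbefore s hs)] at this) t₁ (right_mem_Icc.2 ht₁.1)
      have h2 : ‖y t₁‖ = B + 1 := ht₁B
      linarith
    exact ⟨y, hy0, fun t ht => by simpa only [hχ _ (hlt t ht).le] using hy t ht⟩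
  choose y hy0 hy using fun n : ℕ => key n n.cast_nonneg
  have hagree : ∀ (n k : ℕ) (t : ℝ), 0 ≤ t → t ≤ n → t ≤ k → y n t = y k t := by
    intro n k t ht hn hk
    have hle : (Icc 0 t) ⊆ Icc 0 (n : ℝ) := Icc_subset_Icc_right hn
    have hle' : (Icc 0 t) ⊆ Icc 0 (k : ℝ) := Icc_subset_Icc_right hk
    exact eqOn_Icc_of_hasDerivWithinAt hF (fun s hs => (hy n s (hle hs)).mono hle)
      (fun s hs => (hy k s (hle' hs)).mono hle') ((hy0 n).trans (hy0 k).symm) (right_mem_Icc.2 ht)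
  refine ⟨fun t => y ⌈t⌉₊ t, hy0 _, fun t ht => ?_⟩
  have ht' : 0 ≤ t := ht
  have hn : t < (⌈t⌉₊ + 1 : ℕ) := (Nat.le_ceil t).trans_lt (by push_cast; linarith)
  have h1 := hy (⌈t⌉₊ + 1) t ⟨ht', hn.le⟩
  have hmem : Icc 0 ((⌈t⌉₊ + 1 : ℕ) : ℝ) ∈ 𝓝[Ici 0] t := by
    have : Ici 0 ∩ Iic ((⌈t⌉₊ + 1 : ℕ) : ℝ) ∈ 𝓝[Ici 0] t :=
      inter_mem_nhdsWithin _ (Iic_mem_nhds hn)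
    rwa [Ici_inter_Iic] at this
  have h2 := h1.mono_of_mem_nhdsWithin hmem
  rw [← hagree _ _ t ht' (Nat.le_ceil t) hn.le] at h2
  refine h2.congr_of_eventuallyEq_of_mem ?_ ht
  filter_upwards [hmem] with s hs
  exact hagree _ _ s hs.1 (Nat.le_ceil s) hs.2

end ODE

/-! ### The communication graph -/

section Graph

variable {N m : ℕ}

open Classical in
/-- The entry `a_ij` of the adjacency matrix, equal to `1` if `(j, i)` is an edge and to `0`
otherwise. -/
def edgeWeight (G : Digraph (Option (Fin N))) (i : Fin N) (j : Option (Fin N)) : ℝ :=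
  if G.Adj j (some i) then 1 else 0

theorem edgeWeight_nonneg (G : Digraph (Option (Fin N))) (i : Fin N) (j : Option (Fin N)) :
    0 ≤ edgeWeight G i j := by
  unfold edgeWeight
  split_ifs <;> norm_num

theorem localError_eq (G : Digraph (Option (Fin N))) (v : Vec m) (vh : Fin N → Vec m)
    (i : Fin N) :
    localError G v vh i = edgeWeight G i none • (v - vh i)
      + ∑ k, edgeWeight G i (some k) • (vh k - vh i) := by
  classical
  simp only [localError, Finset.sum_filter, Fintype.sum_option, edgeWeight, ite_smul, one_smul,
    zero_smul, Option.elim]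

theorem localError_eq_sub (G : Digraph (Option (Fin N))) (v : Vec m) (vh : Fin N → Vec m) :
    localError G v vh = localError G 0 (fun j => vh j - v) := by
  funext i
  simp only [localError_eq, zero_sub, neg_sub, sub_sub_sub_cancel_right]

theorem HasDerivWithinAt.localError (G : Digraph (Option (Fin N))) {J : Set ℝ} {t : ℝ}
    {u : ℝ → Fin N → Vec m} {u' : Fin N → Vec m}
    (h : ∀ i, HasDerivWithinAt (fun r => u r i) (u' i) J t) (i : Fin N) :
    HasDerivWithinAt (fun r => localError G 0 (u r) i) (localError G 0 u' i) J t := by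
  simp only [localError_eq, zero_sub]
  exact ((h i).neg.const_smul (edgeWeight G i none)).add
    (HasDerivWithinAt.fun_sum fun k _ => ((h k).sub (h i)).const_smul (edgeWeight G i (some k)))

section Energy

variable {G : Digraph (Option (Fin N))}

theorem edgeWeight_comm (hG : IsLeaderFollowingGraph G) (i k : Fin N) :
    edgeWeight G i (some k) = edgeWeight G k (some i) := by
  classical
  unfold edgeWeight
  exact if_congr ⟨hG.undirected k i, hG.undirected i k⟩ rfl rfl

/-- The bilinear form of the Laplacian of the followers, written as a sum over the edges. -/
theorem sum_inner_localError (hG : IsLeaderFollowingGraph G) (u w : Fin N → Vec m) :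
    ∑ i, inner ℝ (u i) (localError G 0 w i) =
      -(∑ i, edgeWeight G i none * inner ℝ (u i) (w i)
        + (1 / 2) * ∑ i, ∑ k, edgeWeight G i (some k) * inner ℝ (u k - u i) (w k - w i)) := by
  have h1 : ∀ i, inner ℝ (u i) (localError G 0 w i) =
      -(edgeWeight G i none * inner ℝ (u i) (w i))
        + ∑ k, edgeWeight G i (some k) * inner ℝ (u i) (w k - w i) := fun i => by
    rw [localError_eq, inner_add_right, inner_sum, inner_smul_right, zero_sub, inner_neg_right]
    simp only [inner_smul_right, mul_neg]
  have h2 : ∑ i, ∑ k, edgeWeight G i (some k) * inner ℝ (u k) (w k - w i) =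
      -∑ i, ∑ k, edgeWeight G i (some k) * inner ℝ (u i) (w k - w i) := by
    rw [Finset.sum_comm, ← Finset.sum_neg_distrib]
    refine Finset.sum_congr rfl fun i _ => ?_
    rw [← Finset.sum_neg_distrib]
    refine Finset.sum_congr rfl fun k _ => ?_
    rw [edgeWeight_comm hG, ← mul_neg, ← inner_neg_right, neg_sub]
  have h3 : ∑ i, ∑ k, edgeWeight G i (some k) * inner ℝ (u k - u i) (w k - w i) =
      -(2 * ∑ i, ∑ k, edgeWeight G i (some k) * inner ℝ (u i) (w k - w i)) := by
    simp only [inner_sub_left (𝕜 := ℝ), mul_sub, Finset.sum_sub_distrib] at h2 ⊢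
    linarith
  rw [Finset.sum_congr rfl fun i _ => h1 i, Finset.sum_add_distrib, h3, Finset.sum_neg_distrib]
  ring

theorem sum_inner_localError_comm (hG : IsLeaderFollowingGraph G) (u w : Fin N → Vec m) :
    ∑ i, inner ℝ (u i) (localError G 0 w i) = ∑ i, inner ℝ (w i) (localError G 0 u i) := by
  rw [sum_inner_localError hG, sum_inner_localError hG]
  simp only [real_inner_comm]

/-- The Laplacian of the followers is positive definite: a vector of zero energy agrees along every
edge, hence vanishes along the paths of the spanning tree. -/
theorem exists_pos_mul_sq_norm_le_energy (m : ℕ) (hG : IsLeaderFollowingGraph G) :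
    ∃ c : ℝ, 0 < c ∧ ∀ u : Fin N → Vec m,
      c * ‖u‖ ^ 2 ≤ -∑ i, inner ℝ (u i) (localError G 0 u i) := by
  apply exists_pos_mul_sq_norm_le
  · simp only [localError_eq]
    fun_prop
  · intro c u
    rw [sum_inner_localError hG, sum_inner_localError hG]
    simp only [Pi.smul_apply, ← smul_sub, inner_smul_left, inner_smul_right, neg_neg, mul_add,
      Finset.mul_sum, conj_trivial]
    congr 1
    · exact Finset.sum_congr rfl fun i _ => by ring
    · exact Finset.sum_congr rfl fun i _ => Finset.sum_congr rfl fun k _ => by ring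
  · intro u hu
    rw [sum_inner_localError hG, neg_neg]
    by_contra! hle
    have hA : ∀ i, 0 ≤ edgeWeight G i none * inner ℝ (u i) (u i) := fun i =>
      mul_nonneg (edgeWeight_nonneg _ _ _) real_inner_self_nonneg
    have hB : ∀ i k, 0 ≤ edgeWeight G i (some k) * inner ℝ (u k - u i) (u k - u i) := fun i k =>
      mul_nonneg (edgeWeight_nonneg _ _ _) real_inner_self_nonneg
    have hA' := Finset.sum_nonneg fun i (_ : i ∈ Finset.univ) => hA i
    have hB1 := fun i => Finset.sum_nonneg fun k (_ : k ∈ Finset.univ) => hB i k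
    have hB' := Finset.sum_nonneg fun i (_ : i ∈ Finset.univ) => hB1 i
    have hA0 := (Finset.sum_eq_zero_iff_of_nonneg fun i _ => hA i).1
      (le_antisymm (by linarith) hA')
    have hB0 : ∀ i k, edgeWeight G i (some k) * inner ℝ (u k - u i) (u k - u i) = 0 := fun i k =>
      (Finset.sum_eq_zero_iff_of_nonneg fun k _ => hB i k).1
        ((Finset.sum_eq_zero_iff_of_nonneg fun i _ => hB1 i).1
          (le_antisymm (by linarith) hB') i (Finset.mem_univ i)) k (Finset.mem_univ k)
    obtain ⟨T, hTG, -, -, hreach⟩ := hG.spanningTree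
    have hzero : ∀ w : Option (Fin N), w.elim 0 u = 0 := fun w => by
      induction hreach w with
      | refl => rfl
      | @tail j w _ hjw ih =>
        have hadj := hTG _ _ hjw
        cases w with
        | none => rfl
        | some i =>
          cases j with
          | none =>
            have := hA0 i (Finset.mem_univ i)
            simpa [edgeWeight, hadj] using this
          | some k =>
            have := hB0 i k
            simp only [edgeWeight, hadj, if_true, one_mul, inner_self_eq_zero, sub_eq_zero] at this
            exact this.symm.trans ih
    exact hu (funext fun i => hzero (some i))

theorem exists_norm_le_mul_norm_localError (m : ℕ) (hG : IsLeaderFollowingGraph G) :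
    ∃ C : ℝ, ∀ u : Fin N → Vec m, ‖u‖ ≤ C * ‖localError G 0 u‖ := by
  obtain ⟨c, hc, h⟩ := exists_pos_mul_sq_norm_le_energy m hG
  refine ⟨N / c, fun u => ?_⟩
  have h1 : -∑ i, inner ℝ (u i) (localError G 0 u i) ≤ N * (‖u‖ * ‖localError G 0 u‖) := by
    rw [← Finset.sum_neg_distrib]
    refine (Finset.sum_le_sum (g := fun _ => ‖u‖ * ‖localError G 0 u‖) fun i _ => ?_).trans
      (by simp)
    rw [← inner_neg_left]
    refine (real_inner_le_norm _ _).trans ?_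
    rw [norm_neg]
    exact mul_le_mul (norm_le_pi_norm u i) (norm_le_pi_norm _ i) (norm_nonneg _) (norm_nonneg _)
  rcases (norm_nonneg u).eq_or_lt with h0 | h0
  · rw [← h0]
    positivity
  · rw [div_mul_eq_mul_div, le_div_iff₀ hc]
    refine le_of_mul_le_mul_left ?_ h0
    linarith [h u]

end Energy

/-- The network error is controlled by the local errors with a constant that does not depend on the
graph, since there are finitely many graphs with `N` followers. -/
theorem exists_uniform_norm_le_mul_norm_localError (N m : ℕ) :
    ∃ C : ℝ, 0 < C ∧ ∀ G : Digraph (Option (Fin N)), IsLeaderFollowingGraph G →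
      ∀ u : Fin N → Vec m, ‖u‖ ≤ C * ‖localError G 0 u‖ := by
  have hfin : Finite (Digraph (Option (Fin N))) :=
    Finite.of_injective Digraph.Adj fun G H h => by ext a b; rw [h]
  have hex : ∀ G : Digraph (Option (Fin N)), ∃ C : ℝ, IsLeaderFollowingGraph G →
      ∀ u : Fin N → Vec m, ‖u‖ ≤ C * ‖localError G 0 u‖ := fun G => by
    by_cases hG : IsLeaderFollowingGraph G
    · obtain ⟨C, hC⟩ := exists_norm_le_mul_norm_localError m hG
      exact ⟨C, fun _ => hC⟩
    · exact ⟨0, fun h => absurd h hG⟩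
  choose C hC using hex
  obtain ⟨B, hB⟩ := (finite_range C).bddAbove
  refine ⟨max B 1, by positivity, fun G hG u => (hC G hG u).trans ?_⟩
  gcongr
  exact (hB (mem_range_self G)).trans (le_max_left _ _)

end Graph

/-! ### The closed loop as an autonomous equation -/

/-- The normed space of the states of the closed loop. -/
abbrev ClosedLoopSpace (N n m l p : ℕ) : Type :=
  Vec m × (Fin N → Vec m) × (Fin N → Vec l) × (Fin N → ℝ) × (Fin N → Vec p) ×
    (Fin N → Vec n) × (Fin N → Vec n)

section Field

theorem HasDerivWithinAt.prod_fst {A B : Type*} [NormedAddCommGroup A] [NormedSpace ℝ A]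
    [NormedAddCommGroup B] [NormedSpace ℝ B] {f : ℝ → A × B} {f' : A × B} {J : Set ℝ} {t : ℝ}
    (h : HasDerivWithinAt f f' J t) : HasDerivWithinAt (fun r => (f r).1) f'.1 J t :=
  (ContinuousLinearMap.fst ℝ A B).hasFDerivAt.comp_hasDerivWithinAt t h

theorem HasDerivWithinAt.prod_snd {A B : Type*} [NormedAddCommGroup A] [NormedSpace ℝ A]
    [NormedAddCommGroup B] [NormedSpace ℝ B] {f : ℝ → A × B} {f' : A × B} {J : Set ℝ} {t : ℝ}
    (h : HasDerivWithinAt f f' J t) : HasDerivWithinAt (fun r => (f r).2) f'.2 J t :=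
  (ContinuousLinearMap.snd ℝ A B).hasFDerivAt.comp_hasDerivWithinAt t h

variable {N n m l p : ℕ}

/-- Stated separately since instance search on the nested product is slow. -/
instance : ContinuousSMul ℝ (ClosedLoopSpace N n m l p) := IsBoundedSMul.continuousSMul

/-- The state of the closed loop with given coordinates in `ClosedLoopSpace`. -/
def LoopState.ofVec (y : ClosedLoopSpace N n m l p) : LoopState N n m l p :=
  ⟨y.1, y.2.1, y.2.2.1, y.2.2.2.1, y.2.2.2.2.1, y.2.2.2.2.2.1, y.2.2.2.2.2.2⟩

/-- The coordinates of a state of the closed loop. -/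
def LoopState.toVec (x : LoopState N n m l p) : ClosedLoopSpace N n m l p :=
  (x.v, x.vh, x.wh, x.κ, x.θh, x.q, x.dq)

variable (φ : Vec m → Vec l →L[ℝ] Vec m) (ω : Vec l) (E : Vec m →L[ℝ] Vec n)
  (Gr : Digraph (Option (Fin N))) (S : Fin N → ELSystem n p) (D : Design N n m p)

/-- The acceleration `M⁻¹ (τ - C q' - G)` of follower `i`. -/
def accel (x : LoopState N n m l p) (i : Fin N) : Vec n :=
  ((S i).M (x.q i)).inverse (torque φ E Gr D x i (S i).Y
    - (S i).C (x.q i) (x.dq i) (x.dq i) - (S i).G (x.q i))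

/-- The vector field of the closed loop. -/
def loopField (x : LoopState N n m l p) : ClosedLoopSpace N n m l p :=
  (φ x.v ω, vhRate φ Gr D x, whRate φ Gr D x, κRate Gr D x,
    fun i => θhRate φ E Gr D x i (S i).Y, x.dq, accel φ E Gr S D x)

/-- `x` follows the vector field of the closed loop on the set of times `J`. -/
def FollowsLoop (J : Set ℝ) (x : ℝ → LoopState N n m l p) : Prop :=
  ∀ t ∈ J, HasDerivWithinAt (fun r => (x r).toVec) (loopField φ ω E Gr S D (x t)) J t

variable {φ ω E Gr S D} {J : Set ℝ} {x : ℝ → LoopState N n m l p} {t : ℝ}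

namespace FollowsLoop

theorem leader (h : FollowsLoop φ ω E Gr S D J x) (ht : t ∈ J) :
    HasDerivWithinAt (fun r => (x r).v) (φ (x t).v ω) J t :=
  (h t ht).prod_fst

theorem observer_v (h : FollowsLoop φ ω E Gr S D J x) (ht : t ∈ J) (i : Fin N) :
    HasDerivWithinAt (fun r => (x r).vh i) (vhRate φ Gr D (x t) i) J t :=
  hasDerivWithinAt_pi.1 (h t ht).prod_snd.prod_fst i

theorem observer_w (h : FollowsLoop φ ω E Gr S D J x) (ht : t ∈ J) (i : Fin N) :
    HasDerivWithinAt (fun r => (x r).wh i) (whRate φ Gr D (x t) i) J t :=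
  hasDerivWithinAt_pi.1 (h t ht).prod_snd.prod_snd.prod_fst i

theorem observer_κ (h : FollowsLoop φ ω E Gr S D J x) (ht : t ∈ J) (i : Fin N) :
    HasDerivWithinAt (fun r => (x r).κ i) (κRate Gr D (x t) i) J t :=
  hasDerivWithinAt_pi.1 (h t ht).prod_snd.prod_snd.prod_snd.prod_fst i

theorem adaptation (h : FollowsLoop φ ω E Gr S D J x) (ht : t ∈ J) (i : Fin N) :
    HasDerivWithinAt (fun r => (x r).θh i) (θhRate φ E Gr D (x t) i (S i).Y) J t :=
  hasDerivWithinAt_pi.1 (h t ht).prod_snd.prod_snd.prod_snd.prod_snd.prod_fst i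

theorem velocity (h : FollowsLoop φ ω E Gr S D J x) (ht : t ∈ J) (i : Fin N) :
    HasDerivWithinAt (fun r => (x r).q i) ((x t).dq i) J t :=
  hasDerivWithinAt_pi.1 (h t ht).prod_snd.prod_snd.prod_snd.prod_snd.prod_snd.prod_fst i

theorem acceleration (h : FollowsLoop φ ω E Gr S D J x) (ht : t ∈ J) (i : Fin N) :
    HasDerivWithinAt (fun r => (x r).dq i) (accel φ E Gr S D (x t) i) J t :=
  hasDerivWithinAt_pi.1 (h t ht).prod_snd.prod_snd.prod_snd.prod_snd.prod_snd.prod_snd i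

end FollowsLoop

theorem ELSystem.Admissible.isInvertible {S : ELSystem n p} (hS : S.Admissible) (q : Vec n) :
    (S.M q).IsInvertible := by
  obtain ⟨c₁, c₂, hc₁, -, h⟩ := hS.bounds
  have hinj : Function.Injective (S.M q : Vec n →ₗ[ℝ] Vec n) := by
    rw [injective_iff_map_eq_zero]
    intro a ha
    have h1 := (h q a).1
    have h2 : S.M q a = 0 := ha
    rw [h2, inner_zero_right] at h1
    by_contra hne
    have : 0 < ‖a‖ := norm_pos_iff.2 hne
    nlinarith [mul_pos hc₁ (pow_pos this 2)]
  exact ⟨(LinearEquiv.ofInjectiveEndo _ hinj).toContinuousLinearEquiv, by ext1 a; rfl⟩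

/-- The equations of motion of follower `i` solved for the acceleration. -/
theorem accel_eq_iff (hS : ∀ i, (S i).Admissible) (y : LoopState N n m l p) (i : Fin N)
    (a : Vec n) :
    accel φ E Gr S D y i = a ↔
      (S i).M (y.q i) a + (S i).C (y.q i) (y.dq i) (y.dq i) + (S i).G (y.q i) =
        torque φ E Gr D y i (S i).Y := by
  rw [accel, ((hS i).isInvertible _).inverse_apply_eq, sub_sub, sub_eq_iff_eq_add, eq_comm,
    add_assoc]

theorem IsClosedLoopSolution.followsLoop (hS : ∀ i, (S i).Admissible)
    (h : IsClosedLoopSolution φ ω E Gr S D x) : FollowsLoop φ ω E Gr S D (Ici 0) x := by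
  intro t ht
  refine (h.leader t ht).prodMk ((hasDerivWithinAt_pi.2 fun i => h.observer_v i t ht).prodMk
    ((hasDerivWithinAt_pi.2 fun i => h.observer_w i t ht).prodMk
    ((hasDerivWithinAt_pi.2 fun i => h.observer_κ i t ht).prodMk
    ((hasDerivWithinAt_pi.2 fun i => h.adaptation i t ht).prodMk
    ((hasDerivWithinAt_pi.2 fun i => h.velocity i t ht).prodMk
    (hasDerivWithinAt_pi.2 fun i => ?_))))))
  obtain ⟨a, ha, hdyn⟩ := h.dynamics i t ht
  rwa [(accel_eq_iff hS (x t) i a).2 hdyn]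

theorem FollowsLoop.isClosedLoopSolution (hS : ∀ i, (S i).Admissible)
    (h : FollowsLoop φ ω E Gr S D (Ici 0) x) : IsClosedLoopSolution φ ω E Gr S D x where
  leader _ ht := h.leader ht
  observer_v i _ ht := h.observer_v ht i
  observer_w i _ ht := h.observer_w ht i
  observer_κ i _ ht := h.observer_κ ht i
  adaptation i _ ht := h.adaptation ht i
  velocity i _ ht := h.velocity ht i
  dynamics i _ ht := ⟨_, h.acceleration ht i, (accel_eq_iff hS _ i _).1 rfl⟩

section Smoothness

/-- Over the reals the adjoint is a linear isometry, hence smooth. -/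
theorem ContDiff.clm_adjoint {W : Type*} [NormedAddCommGroup W] [NormedSpace ℝ W] {a b : ℕ}
    {A : W → Vec a →L[ℝ] Vec b} {k : WithTop ℕ∞} (hA : ContDiff ℝ k A) :
    ContDiff ℝ k fun y => ContinuousLinearMap.adjoint (A y) :=
  (ContinuousLinearMap.adjoint (𝕜 := ℝ) (E := Vec a) (F := Vec b)).toContinuousLinearEquiv.contDiff
    |>.comp hA

theorem contDiff_localError (i : Fin N) :
    ContDiff ℝ 1 fun y : ClosedLoopSpace N n m l p => (LoopState.ofVec y).z Gr i := by
  simp only [LoopState.z, localError_eq, LoopState.ofVec]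
  fun_prop

theorem contDiff_rho (hρ : ∀ i, ContDiff ℝ 1 (D.ρ i)) (i : Fin N) :
    ContDiff ℝ 1 fun y : ClosedLoopSpace N n m l p => D.ρ i ((LoopState.ofVec y).z Gr i) :=
  (hρ i).comp (contDiff_localError i)

theorem contDiff_vhRate (hφ : ContDiff ℝ 1 φ) (hρ : ∀ i, ContDiff ℝ 1 (D.ρ i)) (i : Fin N) :
    ContDiff ℝ 1 fun y : ClosedLoopSpace N n m l p => vhRate φ Gr D (LoopState.ofVec y) i := by
  have h1 := contDiff_localError (N := N) (n := n) (m := m) (l := l) (p := p) (Gr := Gr) i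
  have h2 := contDiff_rho (l := l) (Gr := Gr) hρ i
  unfold vhRate
  refine ContDiff.add ?_ (ContDiff.smul (ContDiff.mul ?_ h2) h1)
  · simp only [LoopState.ofVec]
    fun_prop
  · simp only [LoopState.ofVec]
    fun_prop

theorem contDiff_whRate (hφ : ContDiff ℝ 1 φ) (i : Fin N) :
    ContDiff ℝ 1 fun y : ClosedLoopSpace N n m l p => whRate φ Gr D (LoopState.ofVec y) i := by
  unfold whRate
  refine ContDiff.const_smul _ (ContDiff.clm_apply (ContDiff.clm_adjoint ?_) (contDiff_localError i))
  simp only [LoopState.ofVec]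
  fun_prop

theorem contDiff_refVel (hφ : ContDiff ℝ 1 φ) (i : Fin N) :
    ContDiff ℝ 1 fun y : ClosedLoopSpace N n m l p => refVel φ E D (LoopState.ofVec y) i := by
  simp only [refVel, LoopState.ofVec]
  fun_prop

/-- The reference acceleration contains the derivative of `φ`, so that its regularity is the reason
for assuming `φ` to be of class `C²`. -/
theorem contDiff_refAcc (hφ : ContDiff ℝ 2 φ) (hρ : ∀ i, ContDiff ℝ 1 (D.ρ i)) (i : Fin N) :
    ContDiff ℝ 1 fun y : ClosedLoopSpace N n m l p => refAcc φ E Gr D (LoopState.ofVec y) i := by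
  have hφ' : ContDiff ℝ 1 (fderiv ℝ φ) := hφ.fderiv_right (by norm_num)
  have hφ1 : ContDiff ℝ 1 φ := hφ.of_le (by norm_num)
  have hv := contDiff_vhRate (n := n) (p := p) (Gr := Gr) hφ1 hρ i
  have hw := contDiff_whRate (n := n) (p := p) (Gr := Gr) (D := D) hφ1 i
  have hvh : ContDiff ℝ 1 fun y : ClosedLoopSpace N n m l p => (LoopState.ofVec y).vh i := by
    simp only [LoopState.ofVec]
    fun_prop
  have hwh : ContDiff ℝ 1 fun y : ClosedLoopSpace N n m l p => (LoopState.ofVec y).wh i := by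
    simp only [LoopState.ofVec]
    fun_prop
  have hdq : ContDiff ℝ 1 fun y : ClosedLoopSpace N n m l p => (LoopState.ofVec y).dq i := by
    simp only [LoopState.ofVec]
    fun_prop
  unfold refAcc
  exact ((E.contDiff.comp ((hφ1.comp hvh).clm_apply hw)).add
    (E.contDiff.comp (((hφ'.comp hvh).clm_apply hv).clm_apply hwh))).sub
    (ContDiff.const_smul _ (hdq.sub (E.contDiff.comp hv)))

theorem contDiff_slidingVar (hφ : ContDiff ℝ 1 φ) (i : Fin N) :
    ContDiff ℝ 1 fun y : ClosedLoopSpace N n m l p =>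
      slidingVar φ E D (LoopState.ofVec y) i := by
  unfold slidingVar
  refine ContDiff.sub ?_ (contDiff_refVel hφ i)
  simp only [LoopState.ofVec]
  fun_prop

theorem contDiff_regressor (hS : ∀ i, (S i).Admissible) (hφ : ContDiff ℝ 2 φ)
    (hρ : ∀ i, ContDiff ℝ 1 (D.ρ i)) (i : Fin N) :
    ContDiff ℝ 1 fun y : ClosedLoopSpace N n m l p =>
      regressor φ E Gr D (LoopState.ofVec y) i (S i).Y := by
  have hq : ContDiff ℝ 1 fun y : ClosedLoopSpace N n m l p => (LoopState.ofVec y).q i := by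
    simp only [LoopState.ofVec]
    fun_prop
  have hdq : ContDiff ℝ 1 fun y : ClosedLoopSpace N n m l p => (LoopState.ofVec y).dq i := by
    simp only [LoopState.ofVec]
    fun_prop
  exact (hS i).smooth_Y.comp (hq.prodMk (hdq.prodMk ((contDiff_refAcc hφ hρ i).prodMk
    (contDiff_refVel (hφ.of_le (by norm_num)) i))))

theorem contDiff_torque (hS : ∀ i, (S i).Admissible) (hφ : ContDiff ℝ 2 φ)
    (hρ : ∀ i, ContDiff ℝ 1 (D.ρ i)) (i : Fin N) :
    ContDiff ℝ 1 fun y : ClosedLoopSpace N n m l p =>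
      torque φ E Gr D (LoopState.ofVec y) i (S i).Y := by
  unfold torque
  refine (((D.K i).contDiff.comp (contDiff_slidingVar (hφ.of_le (by norm_num)) i)).neg).add
    ((contDiff_regressor hS hφ hρ i).clm_apply ?_)
  simp only [LoopState.ofVec]
  fun_prop

theorem contDiff_accel (hS : ∀ i, (S i).Admissible) (hφ : ContDiff ℝ 2 φ)
    (hρ : ∀ i, ContDiff ℝ 1 (D.ρ i)) (i : Fin N) :
    ContDiff ℝ 1 fun y : ClosedLoopSpace N n m l p =>
      accel φ E Gr S D (LoopState.ofVec y) i := by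
  have hq : ContDiff ℝ 1 fun y : ClosedLoopSpace N n m l p => (LoopState.ofVec y).q i := by
    simp only [LoopState.ofVec]
    fun_prop
  have hdq : ContDiff ℝ 1 fun y : ClosedLoopSpace N n m l p => (LoopState.ofVec y).dq i := by
    simp only [LoopState.ofVec]
    fun_prop
  have hinv : ContDiff ℝ 1 fun q => ((S i).M q).inverse := contDiff_iff_contDiffAt.2 fun q =>
    ((hS i).isInvertible q).contDiffAt_map_inverse.comp q (hS i).smooth_M.contDiffAt
  unfold accel
  exact (hinv.comp hq).clm_apply (((contDiff_torque hS hφ hρ i).sub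
    (((hS i).smooth_C.comp (hq.prodMk hdq)).clm_apply hdq)).sub ((hS i).smooth_G.comp hq))

theorem contDiff_loopField (hS : ∀ i, (S i).Admissible) (hφ : ContDiff ℝ 2 φ)
    (hρ : ∀ i, ContDiff ℝ 1 (D.ρ i)) :
    ContDiff ℝ 1 fun y : ClosedLoopSpace N n m l p =>
      loopField φ ω E Gr S D (LoopState.ofVec y) := by
  have hφ1 : ContDiff ℝ 1 φ := hφ.of_le (by norm_num)
  refine ContDiff.prodMk ?_ ((contDiff_pi.2 fun i => contDiff_vhRate hφ1 hρ i).prodMk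
    ((contDiff_pi.2 fun i => contDiff_whRate hφ1 i).prodMk
    ((contDiff_pi.2 fun i => ?_).prodMk ((contDiff_pi.2 fun i => ?_).prodMk
    (ContDiff.prodMk ?_ (contDiff_pi.2 fun i => contDiff_accel hS hφ hρ i))))))
  · simp only [LoopState.ofVec]
    fun_prop
  · exact (contDiff_rho hρ i).mul ((contDiff_localError i).inner ℝ (contDiff_localError i))
  · exact ((D.Γ i).contDiff.comp ((contDiff_regressor hS hφ hρ i).clm_adjoint.clm_apply
      (contDiff_slidingVar hφ1 i))).neg
  · simp only [LoopState.ofVec]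
    fun_prop

end Smoothness

end Field

/-! ### The observer energy -/

section ObserverEnergy

variable {N n m l p : ℕ} {φ : Vec m → Vec l →L[ℝ] Vec m} {ω : Vec l} {E : Vec m →L[ℝ] Vec n}
  {Gr : Digraph (Option (Fin N))} {S : Fin N → ELSystem n p} {D : Design N n m p}
  {J : Set ℝ} {x : ℝ → LoopState N n m l p} {t : ℝ}

/-- The energy of the observers: the Laplacian form of the network error, whose entries are the
`v̂_i - v`, plus weighted squared distances of the `ω̂_i` to `ω` and of the gains `κ̂_i` to a
comparison gain `k`. -/
def observerEnergy (ω : Vec l) (Gr : Digraph (Option (Fin N))) (μ k : ℝ)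
    (y : LoopState N n m l p) : ℝ :=
  -(1 / 2) * ∑ i, inner ℝ (y.vh i - y.v) (y.z Gr i)
    + (2 * μ)⁻¹ * ∑ i, ‖y.wh i - ω‖ ^ 2 + (1 / 2) * ∑ i, (y.κ i - k) ^ 2

theorem FollowsLoop.hasDerivWithinAt_observerEnergy (h : FollowsLoop φ ω E Gr S D J x)
    (hGr : IsLeaderFollowingGraph Gr) (hμ : 0 < D.μ) (k : ℝ) (ht : t ∈ J) :
    HasDerivWithinAt (fun r => observerEnergy ω Gr D.μ k (x r))
      (∑ i, inner ℝ (-((x t).z Gr i)) ((φ ((x t).vh i) - φ (x t).v) ω)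
        - k * ∑ i, D.ρ i ((x t).z Gr i) * ‖(x t).z Gr i‖ ^ 2) J t := by
  have hz : ∀ y : LoopState N n m l p, y.z Gr = localError Gr 0 (fun i => y.vh i - y.v) :=
    fun y => localError_eq_sub Gr y.v y.vh
  have hu := fun i => (h.observer_v ht i).sub (h.leader ht)
  have h1 := HasDerivWithinAt.fun_sum (u := Finset.univ) fun i _ =>
    (hu i).inner ℝ (HasDerivWithinAt.localError Gr hu i)
  have h2 := HasDerivWithinAt.fun_sum (u := Finset.univ) fun i _ =>
    ((h.observer_w ht i).sub_const ω).norm_sq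
  have h3 := HasDerivWithinAt.fun_sum (u := Finset.univ) fun i _ =>
    ((h.observer_κ ht i).sub_const k).pow 2
  have h4 := ((h1.const_mul (-(1 / 2))).add (h2.const_mul (2 * D.μ)⁻¹)).add (h3.const_mul (1 / 2))
  refine (h4.congr_deriv ?_).congr_of_eventuallyEq_of_mem
    (Eventually.of_forall fun r => ?_) ht
  · rw [Finset.sum_add_distrib, sum_inner_localError_comm hGr, ← Finset.sum_add_distrib]
    simp only [Finset.mul_sum, ← Finset.sum_add_distrib, ← Finset.sum_sub_distrib]
    refine Finset.sum_congr rfl fun i _ => ?_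
    have hzi : localError Gr 0 (fun i => (x t).vh i - (x t).v) i = (x t).z Gr i := by rw [hz]
    simp only [Pi.sub_apply, hzi, vhRate, whRate, κRate, inner_smul_right,
      ContinuousLinearMap.adjoint_inner_right, map_sub, inner_sub_left, inner_add_left,
      inner_smul_left, inner_neg_left, inner_sub_right, real_inner_self_eq_norm_sq,
      sub_apply, conj_trivial]
    rw [real_inner_comm (φ ((x t).vh i) ω) ((x t).z Gr i),
      real_inner_comm (φ (x t).v ω) ((x t).z Gr i)]
    field_simp
    ring
  · simp [observerEnergy, hz]

/-- The mismatch `φ(v̂_i) ω - φ(v) ω` is dominated by the dissipation `∑ ρ_i(z_i) |z_i|²`. Only the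
constant depends on the bound `R` of the leader and on `ω`, the functions `ρ_i` do not. Indeed `v`
and `v̂_i` lie in the ball whose radius is the larger of `2 * R` and `2 * (C * ‖z_k‖)`, where `z_k` is
the largest local error; hence the Lipschitz constant of `φ` is at most the product of
`g (2 * R)` and `g (2 * (C * ‖z_k‖))`, and the second factor is at most `ρ_k(z_k)`. -/
theorem sum_inner_mismatch_le {g : ℝ → ℝ} {C R : ℝ} (hg1 : ∀ r, 1 ≤ g r)
    (hφ : ∀ r a b, ‖a‖ ≤ r → ‖b‖ ≤ r → ‖φ a - φ b‖ ≤ g r * ‖a - b‖) (hC : 0 < C)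
    (hGr : ∀ u : Fin N → Vec m, ‖u‖ ≤ C * ‖localError Gr 0 u‖)
    (hρ : ∀ i z, g (2 * (C * ‖z‖)) ≤ D.ρ i z) (y : LoopState N n m l p) (hy : ‖y.v‖ ≤ R) :
    ∑ i, inner ℝ (-(y.z Gr i)) ((φ (y.vh i) - φ y.v) ω) ≤
      (N * (g (2 * R) * C * ‖ω‖)) * ∑ i, D.ρ i (y.z Gr i) * ‖y.z Gr i‖ ^ 2 := by
  have hz : y.z Gr = localError Gr 0 (fun i => y.vh i - y.v) := localError_eq_sub Gr y.v y.vh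
  have hu := hGr fun i => y.vh i - y.v
  rw [← hz] at hu
  have hρ0 : ∀ i z, 0 ≤ D.ρ i z := fun i z => zero_le_one.trans ((hg1 _).trans (hρ i z))
  have hterm : ∀ i, inner ℝ (-(y.z Gr i)) ((φ (y.vh i) - φ y.v) ω) ≤
      (g (2 * R) * C * ‖ω‖) * ∑ i, D.ρ i (y.z Gr i) * ‖y.z Gr i‖ ^ 2 := by
    intro i
    obtain ⟨k, -, hk⟩ := Finset.exists_max_image Finset.univ (fun j => ‖y.z Gr j‖)
      ⟨i, Finset.mem_univ i⟩
    have hk' : ‖y.z Gr‖ = ‖y.z Gr k‖ := le_antisymm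
      ((pi_norm_le_iff_of_nonneg (norm_nonneg _)).2 fun j => hk j (Finset.mem_univ j))
      (norm_le_pi_norm _ k)
    rw [hk'] at hu
    have hui : ‖y.vh i - y.v‖ ≤ C * ‖y.z Gr k‖ :=
      (norm_le_pi_norm (fun i => y.vh i - y.v) i).trans hu
    have hCz : 0 ≤ C * ‖y.z Gr k‖ := by positivity
    have hR : 0 ≤ R := (norm_nonneg _).trans hy
    have hvh : ‖y.vh i‖ ≤ max (2 * R) (2 * (C * ‖y.z Gr k‖)) := by
      have h1 := norm_le_norm_add_norm_sub' (y.vh i) y.v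
      rcases le_total R (C * ‖y.z Gr k‖) with h2 | h2
      · exact le_max_of_le_right (by linarith)
      · exact le_max_of_le_left (by linarith)
    have hv : ‖y.v‖ ≤ max (2 * R) (2 * (C * ‖y.z Gr k‖)) := le_max_of_le_left (by linarith)
    have hgmax : g (max (2 * R) (2 * (C * ‖y.z Gr k‖))) ≤ g (2 * R) * D.ρ k (y.z Gr k) := by
      have h1 := hg1 (2 * R)
      have h2 := hρ k (y.z Gr k)
      have h3 := hg1 (2 * (C * ‖y.z Gr k‖))
      rcases le_total (2 * R) (2 * (C * ‖y.z Gr k‖)) with h | h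
      · rw [max_eq_right h]
        nlinarith
      · rw [max_eq_left h]
        nlinarith
    calc inner ℝ (-(y.z Gr i)) ((φ (y.vh i) - φ y.v) ω)
        ≤ ‖y.z Gr i‖ * ‖(φ (y.vh i) - φ y.v) ω‖ := by
          simpa using real_inner_le_norm (-(y.z Gr i)) ((φ (y.vh i) - φ y.v) ω)
      _ ≤ ‖y.z Gr k‖ * ((g (2 * R) * D.ρ k (y.z Gr k)) * (C * ‖y.z Gr k‖) * ‖ω‖) := by
          refine mul_le_mul (hk i (Finset.mem_univ i)) ?_ (norm_nonneg _) (norm_nonneg _)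
          refine (ContinuousLinearMap.le_opNorm _ _).trans ?_
          refine mul_le_mul_of_nonneg_right ?_ (norm_nonneg _)
          refine (hφ _ _ _ hvh hv).trans ?_
          refine mul_le_mul hgmax hui (norm_nonneg _) ?_
          exact mul_nonneg (zero_le_one.trans (hg1 _)) (hρ0 _ _)
      _ = (g (2 * R) * C * ‖ω‖) * (D.ρ k (y.z Gr k) * ‖y.z Gr k‖ ^ 2) := by ring
      _ ≤ _ := by
          refine mul_le_mul_of_nonneg_left ?_
            (mul_nonneg (mul_nonneg (zero_le_one.trans (hg1 _)) hC.le) (norm_nonneg _))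
          exact Finset.single_le_sum (f := fun j => D.ρ j (y.z Gr j) * ‖y.z Gr j‖ ^ 2)
            (fun j _ => mul_nonneg (hρ0 _ _) (sq_nonneg _)) (Finset.mem_univ k)
  refine (Finset.sum_le_sum fun i _ => hterm i).trans (le_of_eq ?_)
  rw [Finset.sum_const, Finset.card_univ, Fintype.card_fin, nsmul_eq_mul]
  ring

theorem le_one_add_of_sq_le {a b : ℝ} (h : a ^ 2 ≤ b) : a ≤ 1 + b := by
  nlinarith [sq_nonneg (a - 1)]

theorem observerEnergy_nonneg (hGr : IsLeaderFollowingGraph Gr) {μ : ℝ} (hμ : 0 < μ) (k : ℝ)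
    (y : LoopState N n m l p) : 0 ≤ observerEnergy ω Gr μ k y := by
  obtain ⟨c, hc, hQ⟩ := exists_pos_mul_sq_norm_le_energy m hGr
  have h1 := hQ fun i => y.vh i - y.v
  rw [← localError_eq_sub Gr y.v y.vh] at h1
  have h2 : 0 ≤ c * ‖fun i => y.vh i - y.v‖ ^ 2 := by positivity
  have h3 : 0 ≤ (2 * μ)⁻¹ * ∑ i, ‖y.wh i - ω‖ ^ 2 := by positivity
  have h4 : 0 ≤ (1 / 2) * ∑ i, (y.κ i - k) ^ 2 := by positivity
  unfold observerEnergy LoopState.z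
  linarith

theorem exists_bound_of_observerEnergy_le (ω : Vec l) (hGr : IsLeaderFollowingGraph Gr) {μ : ℝ}
    (hμ : 0 < μ) (k R V : ℝ) :
    ∃ B : ℝ, ∀ y : LoopState N n m l p, ‖y.v‖ ≤ R → observerEnergy ω Gr μ k y ≤ V →
      ∀ i, ‖y.vh i‖ ≤ B ∧ ‖y.wh i‖ ≤ B ∧ ‖y.κ i‖ ≤ B := by
  obtain ⟨c, hc, hQ⟩ := exists_pos_mul_sq_norm_le_energy m hGr
  refine ⟨max (R + (1 + 2 * V / c)) (max (‖ω‖ + (1 + 2 * μ * V)) (|k| + (1 + 2 * V))),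
    fun y hv hV i => ?_⟩
  have h1 := hQ fun i => y.vh i - y.v
  rw [← localError_eq_sub Gr y.v y.vh] at h1
  have h2 : 0 ≤ c * ‖fun i => y.vh i - y.v‖ ^ 2 := by positivity
  have h3 : 0 ≤ (2 * μ)⁻¹ * ∑ i, ‖y.wh i - ω‖ ^ 2 := by positivity
  have h4 : 0 ≤ (1 / 2) * ∑ i, (y.κ i - k) ^ 2 := by positivity
  unfold observerEnergy LoopState.z at hV
  refine ⟨le_max_of_le_left ?_, le_max_of_le_right (le_max_of_le_left ?_),
    le_max_of_le_right (le_max_of_le_right ?_)⟩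
  · have h5 : ‖fun i => y.vh i - y.v‖ ≤ 1 + 2 * V / c := le_one_add_of_sq_le (by
      rw [le_div_iff₀ hc]
      linarith)
    have h6 := norm_le_norm_add_norm_sub' (y.vh i) y.v
    have h7 := norm_le_pi_norm (fun i => y.vh i - y.v) i
    linarith
  · have h5 := Finset.single_le_sum (f := fun i => ‖y.wh i - ω‖ ^ 2) (fun j _ => sq_nonneg _)
      (Finset.mem_univ i)
    have h6 : (2 * μ)⁻¹ * ∑ i, ‖y.wh i - ω‖ ^ 2 ≤ V := by linarith
    rw [inv_mul_le_iff₀ (by positivity)] at h6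
    have h7 := le_one_add_of_sq_le (h5.trans h6)
    have h8 := norm_le_norm_add_norm_sub' (y.wh i) ω
    linarith
  · have h5 := Finset.single_le_sum (f := fun i => (y.κ i - k) ^ 2) (fun j _ => sq_nonneg _)
      (Finset.mem_univ i)
    have h6 : |y.κ i - k| ≤ 1 + 2 * V := le_one_add_of_sq_le (by
      rw [sq_abs]
      linarith)
    have h7 := abs_sub_abs_le_abs_sub (y.κ i) k
    rw [Real.norm_eq_abs]
    linarith

end ObserverEnergy

/-! ### The energy of a follower -/

section FollowerEnergy

variable {N n m l p : ℕ} {φ : Vec m → Vec l →L[ℝ] Vec m} {ω : Vec l} {E : Vec m →L[ℝ] Vec n}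
  {Gr : Digraph (Option (Fin N))} {S : Fin N → ELSystem n p} {D : Design N n m p}
  {J : Set ℝ} {x : ℝ → LoopState N n m l p} {t : ℝ}

theorem Design.Γ_apply (D : Design N n m p) (i : Fin N) (y : Vec p) (j : Fin p) :
    D.Γ i y j = D.γ i j * y j := by
  simp [Design.Γ, Matrix.ofLp_toEuclideanCLM, Matrix.mulVec_diagonal]

/-- The energy of follower `i`: the kinetic energy of the sliding variable plus the squared
parameter error weighted with the inverse adaptation gains. -/
def followerEnergy (φ : Vec m → Vec l →L[ℝ] Vec m) (E : Vec m →L[ℝ] Vec n)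
    (S : Fin N → ELSystem n p) (D : Design N n m p) (i : Fin N) (y : LoopState N n m l p) : ℝ :=
  (1 / 2) * inner ℝ (slidingVar φ E D y i) ((S i).M (y.q i) (slidingVar φ E D y i))
    + (1 / 2) * ∑ j, (D.γ i j)⁻¹ * (y.θh i j - (S i).θ j) ^ 2

theorem FollowsLoop.hasDerivWithinAt_refVel (h : FollowsLoop φ ω E Gr S D J x)
    (hφ : Differentiable ℝ φ) (i : Fin N) (ht : t ∈ J) :
    HasDerivWithinAt (fun r => refVel φ E D (x r) i) (refAcc φ E Gr D (x t) i) J t := by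
  have h1 := (hφ ((x t).vh i)).hasFDerivAt.comp_hasDerivWithinAt t (h.observer_v ht i)
  have h2 := E.hasFDerivAt.comp_hasDerivWithinAt t (h1.clm_apply (h.observer_w ht i))
  have h3 := (h.velocity ht i).sub (E.hasFDerivAt.comp_hasDerivWithinAt t (h.observer_v ht i))
  refine (h2.sub (h3.const_smul D.α)).congr_deriv ?_
  rw [refAcc, map_add, add_comm (E (φ ((x t).vh i) (whRate φ Gr D (x t) i)))]
  rfl

theorem FollowsLoop.hasDerivWithinAt_slidingVar (h : FollowsLoop φ ω E Gr S D J x)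
    (hφ : Differentiable ℝ φ) (i : Fin N) (ht : t ∈ J) :
    HasDerivWithinAt (fun r => slidingVar φ E D (x r) i)
      (accel φ E Gr S D (x t) i - refAcc φ E Gr D (x t) i) J t :=
  (h.acceleration ht i).sub (h.hasDerivWithinAt_refVel hφ i ht)

/-- The linear parametrization turns the equations of motion into equations for the sliding
variable that are driven by the parameter error. -/
theorem M_apply_accel_sub_refAcc (hS : ∀ i, (S i).Admissible) (y : LoopState N n m l p)
    (i : Fin N) :
    (S i).M (y.q i) (accel φ E Gr S D y i - refAcc φ E Gr D y i) =
      -D.K i (slidingVar φ E D y i) - (S i).C (y.q i) (y.dq i) (slidingVar φ E D y i)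
        + regressor φ E Gr D y i (S i).Y (y.θh i - (S i).θ) := by
  have h1 := (accel_eq_iff (φ := φ) (E := E) (Gr := Gr) (D := D) hS y i _).1 rfl
  have h2 := (hS i).linear_param (y.q i) (y.dq i) (refAcc φ E Gr D y i) (refVel φ E D y i)
  rw [torque] at h1
  rw [map_sub, map_sub, show regressor φ E Gr D y i (S i).Y (S i).θ = _ from h2.symm,
    show (S i).C (y.q i) (y.dq i) (slidingVar φ E D y i) = (S i).C (y.q i) (y.dq i) (y.dq i)
      - (S i).C (y.q i) (y.dq i) (refVel φ E D y i) from map_sub _ _ _,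
    ← sub_eq_zero, ← sub_eq_zero.2 h1]
  abel

theorem FollowsLoop.hasDerivWithinAt_followerEnergy (h : FollowsLoop φ ω E Gr S D J x)
    (hS : ∀ i, (S i).Admissible) (hφ : Differentiable ℝ φ) (hD : D.PositiveGains) (i : Fin N)
    (ht : t ∈ J) :
    HasDerivWithinAt (fun r => followerEnergy φ E S D i (x r))
      (-inner ℝ (slidingVar φ E D (x t) i) (D.K i (slidingVar φ E D (x t) i))) J t := by
  have hs := h.hasDerivWithinAt_slidingVar hφ i ht
  have hM := (((hS i).smooth_M.differentiable one_ne_zero) ((x t).q i)).hasFDerivAt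
    |>.comp_hasDerivWithinAt t (h.velocity ht i)
  have h1 := hs.inner ℝ (hM.clm_apply hs)
  have hθ : ∀ j, HasDerivWithinAt (fun r => (x r).θh i j)
      (θhRate φ E Gr D (x t) i (S i).Y j) J t := fun j =>
    (EuclideanSpace.proj (𝕜 := ℝ) j).hasFDerivAt.comp_hasDerivWithinAt t (h.adaptation ht i)
  have h2 := HasDerivWithinAt.fun_sum (u := Finset.univ) fun j _ =>
    (((hθ j).sub_const ((S i).θ j)).pow 2).const_mul (D.γ i j)⁻¹
  refine ((h1.const_mul (1 / 2)).add (h2.const_mul (1 / 2))).congr_deriv ?_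
  simp only [Function.comp_apply]
  set s := slidingVar φ E D (x t) i with hs_def
  set q := (x t).q i
  set dq := (x t).dq i
  set a := accel φ E Gr S D (x t) i - refAcc φ E Gr D (x t) i
  set Y := regressor φ E Gr D (x t) i (S i).Y with hY_def
  have h3 : ∑ j, (D.γ i j)⁻¹ * ((2 : ℕ) * ((x t).θh i j - (S i).θ j) ^ (2 - 1)
      * θhRate φ E Gr D (x t) i (S i).Y j) = -(2 * inner ℝ s (Y ((x t).θh i - (S i).θ))) := by
    rw [← ContinuousLinearMap.adjoint_inner_left, PiLp.inner_apply, Finset.mul_sum,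
      ← Finset.sum_neg_distrib]
    refine Finset.sum_congr rfl fun j _ => ?_
    have hγ := (hD.γ_pos i j).ne'
    simp only [θhRate, PiLp.neg_apply, Design.Γ_apply, PiLp.sub_apply, RCLike.inner_apply,
      conj_trivial, ← hY_def, ← hs_def]
    field_simp
    simp
    ring
  have hskew := (hS i).skew q dq s s
  rw [real_inner_comm] at hskew
  have h4 : inner ℝ s (fderiv ℝ (S i).M q dq s) = 2 * inner ℝ s ((S i).C q dq s) := by
    simp only [sub_apply, smul_apply, inner_sub_right,
      inner_smul_right] at hskew
    linarith
  have h5 : inner ℝ s ((S i).M q a) = -inner ℝ s (D.K i s) - inner ℝ s ((S i).C q dq s)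
      + inner ℝ s (Y ((x t).θh i - (S i).θ)) := by
    rw [M_apply_accel_sub_refAcc hS, inner_add_right, inner_sub_right, inner_neg_right]
  have h6 : inner ℝ a ((S i).M q s) = inner ℝ s ((S i).M q a) := by
    rw [← (hS i).symm, real_inner_comm]
  rw [h3, inner_add_right, h4, h6, h5]
  ring

theorem exists_bound_of_followerEnergy_le (φ : Vec m → Vec l →L[ℝ] Vec m) (E : Vec m →L[ℝ] Vec n)
    (hS : ∀ i, (S i).Admissible) (hD : D.PositiveGains) (i : Fin N) :
    ∃ c : ℝ, 0 < c ∧ ∀ y : LoopState N n m l p,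
      c * ‖slidingVar φ E D y i‖ ^ 2 + c * ‖y.θh i - (S i).θ‖ ^ 2 ≤ followerEnergy φ E S D i y := by
  obtain ⟨c₁, c₂, hc₁, -, hM⟩ := (hS i).bounds
  obtain ⟨c, hc, hγ⟩ := exists_pos_mul_sq_norm_le
    (f := fun y : Vec p => ∑ j, (D.γ i j)⁻¹ * y j ^ 2) (by fun_prop)
    (fun b y => by
      rw [Finset.mul_sum]
      exact Finset.sum_congr rfl fun j _ => by
        rw [PiLp.smul_apply, smul_eq_mul]
        ring)
    (fun y hy => by
      have hγ := fun j => inv_pos.2 (hD.γ_pos i j)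
      by_contra! hle
      refine hy (PiLp.ext fun j => ?_)
      have h0 := (Finset.sum_eq_zero_iff_of_nonneg fun j _ =>
        mul_nonneg (hγ j).le (sq_nonneg (y j))).1
        (le_antisymm hle (Finset.sum_nonneg fun j _ => mul_nonneg (hγ j).le (sq_nonneg _))) j
        (Finset.mem_univ j)
      simpa [(hγ j).ne'] using h0)
  refine ⟨(1 / 2) * min c₁ c, by positivity, fun y => ?_⟩
  have h1 := (hM (y.q i) (slidingVar φ E D y i)).1
  have h2 := hγ (y.θh i - (S i).θ)
  simp only [PiLp.sub_apply] at h2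
  have h3 : min c₁ c * ‖slidingVar φ E D y i‖ ^ 2 ≤ c₁ * ‖slidingVar φ E D y i‖ ^ 2 := by
    gcongr
    exact min_le_left _ _
  have h4 : min c₁ c * ‖y.θh i - (S i).θ‖ ^ 2 ≤ c * ‖y.θh i - (S i).θ‖ ^ 2 := by
    gcongr
    exact min_le_right _ _
  unfold followerEnergy
  linarith

/-- The position of follower `i` relative to the estimated leader output. -/
def trackErr (E : Vec m →L[ℝ] Vec n) (y : LoopState N n m l p) (i : Fin N) : Vec n :=
  y.q i - E (y.vh i)

theorem FollowsLoop.hasDerivWithinAt_trackErr (h : FollowsLoop φ ω E Gr S D J x) (i : Fin N)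
    (ht : t ∈ J) :
    HasDerivWithinAt (fun r => trackErr E (x r) i)
      (slidingVar φ E D (x t) i - D.α • trackErr E (x t) i
        - ((x t).κ i * D.ρ i ((x t).z Gr i)) • E ((x t).z Gr i)) J t := by
  refine ((h.velocity ht i).sub
    (E.hasFDerivAt.comp_hasDerivWithinAt t (h.observer_v ht i))).congr_deriv ?_
  rw [slidingVar, refVel, vhRate, map_add, map_smul, trackErr]
  abel

end FollowerEnergy

/-! ### Boundedness of the closed loop -/

section Boundedness

variable {N n m l p : ℕ} {φ : Vec m → Vec l →L[ℝ] Vec m} {ω : Vec l} {E : Vec m →L[ℝ] Vec n}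
  {Gr : Digraph (Option (Fin N))} {S : Fin N → ELSystem n p} {D : Design N n m p}
  {J : Set ℝ} {x : ℝ → LoopState N n m l p} {x₀ : LoopState N n m l p} {R c k : ℝ} {t : ℝ}

/-- A motion of the closed loop on an interval `J ⊆ [0, ∞)` with left end `0`, along which the
leader stays in the ball of radius `R`. Compact intervals serve the a priori bounds needed for
existence, `[0, ∞)` serves the convergence. -/
structure IsBoundedLeaderRun (φ : Vec m → Vec l →L[ℝ] Vec m) (ω : Vec l) (E : Vec m →L[ℝ] Vec n)
    (Gr : Digraph (Option (Fin N))) (S : Fin N → ELSystem n p) (D : Design N n m p)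
    (x₀ : LoopState N n m l p) (R : ℝ) (J : Set ℝ) (x : ℝ → LoopState N n m l p) : Prop where
  follows : FollowsLoop φ ω E Gr S D J x
  convex : Convex ℝ J
  zero_mem : (0 : ℝ) ∈ J
  subset : J ⊆ Ici 0
  init : x 0 = x₀
  leader_le : ∀ t ∈ J, ‖(x t).v‖ ≤ R

/-- As long as the leader is in the ball of radius `R`, the mismatch of the observers is at most `c`
times their dissipation. -/
def MismatchBound (φ : Vec m → Vec l →L[ℝ] Vec m) (ω : Vec l) (Gr : Digraph (Option (Fin N)))
    (D : Design N n m p) (R c : ℝ) : Prop :=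
  ∀ (v : Vec m) (vh : Fin N → Vec m), ‖v‖ ≤ R →
    ∑ i, inner ℝ (-(localError Gr v vh i)) ((φ (vh i) - φ v) ω) ≤
      c * ∑ i, D.ρ i (localError Gr v vh i) * ‖localError Gr v vh i‖ ^ 2

/-- With the comparison gain `c + 1` the gain term absorbs the mismatch and leaves the whole
dissipation, which is at least `|z_i|²` as `ρ_i ≥ 1`. -/
theorem IsBoundedLeaderRun.observerEnergy_deriv (r : IsBoundedLeaderRun φ ω E Gr S D x₀ R J x)
    (hGr : IsLeaderFollowingGraph Gr) (hD : D.PositiveGains) (hρ1 : ∀ i z, 1 ≤ D.ρ i z)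
    (hc : MismatchBound φ ω Gr D R c) (ht : t ∈ J) :
    ∃ w, HasDerivWithinAt (fun r => observerEnergy ω Gr D.μ (c + 1) (x r)) w J t ∧
      ∀ i, w ≤ -‖(x t).z Gr i‖ ^ 2 := by
  refine ⟨_, r.follows.hasDerivWithinAt_observerEnergy hGr hD.μ_pos (c + 1) ht, fun i => ?_⟩
  have h1 := hc (x t).v (x t).vh (r.leader_le t ht)
  have h2 := Finset.single_le_sum
    (f := fun i => D.ρ i ((x t).z Gr i) * ‖(x t).z Gr i‖ ^ 2)
    (fun j _ => mul_nonneg (zero_le_one.trans (hρ1 _ _)) (sq_nonneg _)) (Finset.mem_univ i)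
  have h3 : ‖(x t).z Gr i‖ ^ 2 ≤ D.ρ i ((x t).z Gr i) * ‖(x t).z Gr i‖ ^ 2 :=
    le_mul_of_one_le_left (sq_nonneg _) (hρ1 _ _)
  unfold LoopState.z at *
  linarith

theorem IsBoundedLeaderRun.le_initial (r : IsBoundedLeaderRun φ ω E Gr S D x₀ R J x)
    {U : LoopState N n m l p → ℝ}
    (hU : ∀ t ∈ J, ∃ w, HasDerivWithinAt (fun r => U (x r)) w J t ∧ w ≤ 0) (ht : t ∈ J) :
    U (x t) ≤ U x₀ := by
  choose! w hw hw0 using hU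
  have h : U (x t) ≤ U (x 0) :=
    antitoneOn_of_hasDerivWithinAt_self r.convex hw hw0 r.zero_mem ht (r.subset ht)
  rwa [r.init] at h

theorem IsBoundedLeaderRun.observerEnergy_le (r : IsBoundedLeaderRun φ ω E Gr S D x₀ R J x)
    (hGr : IsLeaderFollowingGraph Gr) (hD : D.PositiveGains) (hρ1 : ∀ i z, 1 ≤ D.ρ i z)
    (hc : MismatchBound φ ω Gr D R c) (ht : t ∈ J) (i : Fin N) :
    observerEnergy ω Gr D.μ (c + 1) (x t) ≤ observerEnergy ω Gr D.μ (c + 1) x₀ :=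
  r.le_initial (fun _ hs =>
    let ⟨w, hw, hw'⟩ := r.observerEnergy_deriv hGr hD hρ1 hc hs
    ⟨w, hw, (hw' i).trans (neg_nonpos.2 (sq_nonneg _))⟩) ht

/-- The observer states, the observer gains and the part of the reference velocities that does not
involve the positions are bounded on the sublevel sets of the observer energy. -/
theorem exists_observer_bound (hφ : ContDiff ℝ 1 φ) (hGr : IsLeaderFollowingGraph Gr)
    (hD : D.PositiveGains) (hρ : ∀ i, ContDiff ℝ 1 (D.ρ i)) (ω : Vec l) (E : Vec m →L[ℝ] Vec n)
    (k R V : ℝ) :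
    ∃ B : ℝ, 0 ≤ B ∧ ∀ y : LoopState N n m l p, ‖y.v‖ ≤ R → observerEnergy ω Gr D.μ k y ≤ V →
      ∀ i, ‖y.vh i‖ ≤ B ∧ ‖y.wh i‖ ≤ B ∧ ‖y.κ i‖ ≤ B ∧ ‖y.κ i * D.ρ i (y.z Gr i)‖ ≤ B ∧
        ‖refVel φ E D y i + D.α • y.q i‖ ≤ B := by
  obtain ⟨B₀, hB₀⟩ := exists_bound_of_observerEnergy_le (n := n) (p := p) ω hGr hD.μ_pos k R V
  set B₁ := max (max R B₀) 0
  have hc1 : Continuous fun y : ClosedLoopSpace N n m l p =>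
      fun i => (LoopState.ofVec y).κ i * D.ρ i ((LoopState.ofVec y).z Gr i) :=
    continuous_pi fun i => Continuous.mul
      (by simp only [LoopState.ofVec]; fun_prop) (contDiff_rho hρ i).continuous
  have hc2 : Continuous fun y : ClosedLoopSpace N n m l p =>
      fun i => refVel φ E D (LoopState.ofVec y) i :=
    continuous_pi fun i => (contDiff_refVel hφ i).continuous
  obtain ⟨B₂, hB₂⟩ := (isCompact_closedBall (0 : ClosedLoopSpace N n m l p)
    B₁).exists_bound_of_continuousOn hc1.continuousOn
  obtain ⟨B₃, hB₃⟩ := (isCompact_closedBall (0 : ClosedLoopSpace N n m l p)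
    B₁).exists_bound_of_continuousOn hc2.continuousOn
  have hB₁ : 0 ≤ B₁ := le_max_right _ _
  refine ⟨max B₁ (max B₂ B₃), le_max_of_le_left hB₁, fun y hv hV i => ?_⟩
  have hobs := hB₀ y hv hV
  have hle : B₀ ≤ B₁ := (le_max_right _ _).trans (le_max_left _ _)
  -- The last three coordinates do not influence the quantities to be estimated.
  have hmem : (y.v, y.vh, y.wh, y.κ, 0, 0, 0) ∈
      Metric.closedBall (0 : ClosedLoopSpace N n m l p) B₁ := by
    rw [mem_closedBall_zero_iff]
    simp only [Prod.norm_def, norm_zero, sup_le_iff, pi_norm_le_iff_of_nonneg hB₁]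
    exact ⟨hv.trans ((le_max_left _ _).trans (le_max_left _ _)),
      fun j => (hobs j).1.trans hle, fun j => (hobs j).2.1.trans hle,
      fun j => (hobs j).2.2.trans hle, hB₁, hB₁, hB₁⟩
  have h1 := (norm_le_pi_norm _ i).trans (hB₂ _ hmem)
  have h2 := (norm_le_pi_norm _ i).trans (hB₃ _ hmem)
  refine ⟨le_max_of_le_left ((hobs i).1.trans hle), le_max_of_le_left ((hobs i).2.1.trans hle),
    le_max_of_le_left ((hobs i).2.2.trans hle),
    le_max_of_le_right (le_max_of_le_left h1), le_max_of_le_right (le_max_of_le_right ?_)⟩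
  have h3 : refVel φ E D y i + D.α • y.q i =
      refVel φ E D (LoopState.ofVec (y.v, y.vh, y.wh, y.κ, (0 : Fin N → Vec p), 0, 0)) i := by
    simp only [refVel, LoopState.ofVec, Pi.zero_apply, smul_sub, smul_zero]
    abel
  rwa [h3]

/-- A Lyapunov function for the position of follower `i`: the observer energy and the energy of the
follower dissipate `|z_i|²` and `|s_i|²`, the two inputs of the equation of the tracking error. -/
def totalEnergy (φ : Vec m → Vec l →L[ℝ] Vec m) (ω : Vec l) (E : Vec m →L[ℝ] Vec n)
    (Gr : Digraph (Option (Fin N))) (S : Fin N → ELSystem n p) (D : Design N n m p)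
    (k a b : ℝ) (i : Fin N) (y : LoopState N n m l p) : ℝ :=
  a * observerEnergy ω Gr D.μ k y + b * followerEnergy φ E S D i y + ‖trackErr E y i‖ ^ 2

theorem trackErr_dissipation {α B g : ℝ} (hα : 0 < α) (hg : ‖g‖ ≤ B) (E : Vec m →L[ℝ] Vec n)
    (e s : Vec n) (z : Vec m) :
    2 * inner ℝ e (s - α • e - g • E z) ≤
      -(α * ‖e‖ ^ 2) + 2 / α * ‖s‖ ^ 2 + 2 * (B * ‖E‖) ^ 2 / α * ‖z‖ ^ 2 := by
  have h1 : inner ℝ e s ≤ ‖e‖ * ‖s‖ := real_inner_le_norm _ _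
  have h2 : inner ℝ e (-(g • E z)) ≤ ‖e‖ * (B * ‖E‖ * ‖z‖) := by
    refine (real_inner_le_norm _ _).trans (mul_le_mul_of_nonneg_left ?_ (norm_nonneg _))
    rw [norm_neg, norm_smul, mul_assoc]
    exact mul_le_mul hg (E.le_opNorm z) (norm_nonneg _) ((norm_nonneg _).trans hg)
  have h3 : ∀ a b : ℝ, 2 * (a * b) ≤ α / 2 * a ^ 2 + 2 / α * b ^ 2 := fun a b => by
    have h4 : α / 2 * a ^ 2 + 2 / α * b ^ 2 - 2 * (a * b) = (α * a - 2 * b) ^ 2 / (2 * α) := by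
      field_simp
      ring
    have h5 : 0 ≤ (α * a - 2 * b) ^ 2 / (2 * α) := by positivity
    linarith
  have h6 := h3 ‖e‖ ‖s‖
  have h7 := h3 ‖e‖ (B * ‖E‖ * ‖z‖)
  have h8 : inner ℝ e (s - α • e - g • E z) =
      inner ℝ e s - α * ‖e‖ ^ 2 + inner ℝ e (-(g • E z)) := by
    rw [sub_eq_add_neg _ (g • E z), inner_add_right, inner_sub_right, inner_smul_right,
      real_inner_self_eq_norm_sq]
  have h9 : 2 / α * (B * ‖E‖ * ‖z‖) ^ 2 = 2 * (B * ‖E‖) ^ 2 / α * ‖z‖ ^ 2 := by ring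
  rw [h8]
  linarith

/-- The weights of the total energy are chosen so that the dissipation of the observers and of the
follower outweighs the inputs of the tracking error. -/
theorem exists_totalEnergy (hφ : ContDiff ℝ 1 φ) (hS : ∀ i, (S i).Admissible)
    (hGr : IsLeaderFollowingGraph Gr) (hD : D.PositiveGains) (hρ : ∀ i, ContDiff ℝ 1 (D.ρ i))
    (hρ1 : ∀ i z, 1 ≤ D.ρ i z) (hc : MismatchBound φ ω Gr D R c) (E : Vec m →L[ℝ] Vec n)
    (x₀ : LoopState N n m l p) (i : Fin N) :
    ∃ a b : ℝ, 0 < a ∧ 0 < b ∧ ∀ J x, IsBoundedLeaderRun φ ω E Gr S D x₀ R J x → ∀ t ∈ J,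
      ∃ w, HasDerivWithinAt (fun r => totalEnergy φ ω E Gr S D (c + 1) a b i (x r)) w J t ∧
        w ≤ -(‖(x t).z Gr i‖ ^ 2 + D.α * ‖trackErr E (x t) i‖ ^ 2) := by
  obtain ⟨B, hB0, hB⟩ := exists_observer_bound (p := p) hφ hGr hD hρ ω E (c + 1) R
    (observerEnergy ω Gr D.μ (c + 1) x₀)
  obtain ⟨κ, hκ, hK⟩ := exists_pos_mul_sq_norm_le (f := fun y => inner ℝ y (D.K i y))
    (by fun_prop) (fun b y => by
      simp only [map_smul, inner_smul_left, inner_smul_right, conj_trivial]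
      ring) (hD.K_pos i)
  have hα := hD.α_pos
  refine ⟨2 * (B * ‖E‖) ^ 2 / D.α + 1, 2 / (D.α * κ), by positivity, by positivity,
    fun J x r t ht => ?_⟩
  obtain ⟨w, hw, hwle⟩ := r.observerEnergy_deriv hGr hD hρ1 hc ht
  have h1 := r.follows.hasDerivWithinAt_followerEnergy hS (hφ.differentiable one_ne_zero) hD i ht
  have h2 := (r.follows.hasDerivWithinAt_trackErr i ht).norm_sq
  refine ⟨_, ((hw.const_mul _).add (h1.const_mul _)).add h2, ?_⟩
  have h3 := (hB (x t) (r.leader_le t ht) (r.observerEnergy_le hGr hD hρ1 hc ht i) i).2.2.2.1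
  have h4 := trackErr_dissipation hα h3 E (trackErr E (x t) i) (slidingVar φ E D (x t) i)
    ((x t).z Gr i)
  have h5 := hK (slidingVar φ E D (x t) i)
  have h6 : 2 / D.α * ‖slidingVar φ E D (x t) i‖ ^ 2 ≤ 2 / (D.α * κ) *
      inner ℝ (slidingVar φ E D (x t) i) (D.K i (slidingVar φ E D (x t) i)) := by
    have h7 : 2 / D.α * ‖slidingVar φ E D (x t) i‖ ^ 2 =
        2 / (D.α * κ) * (κ * ‖slidingVar φ E D (x t) i‖ ^ 2) := by
      field_simp
    rw [h7]
    gcongr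
  have h8 := mul_le_mul_of_nonneg_left (hwle i)
    (show 0 ≤ 2 * (B * ‖E‖) ^ 2 / D.α + 1 by positivity)
  linarith

theorem followerEnergy_nonneg (φ : Vec m → Vec l →L[ℝ] Vec m) (E : Vec m →L[ℝ] Vec n)
    (hS : ∀ i, (S i).Admissible) (hD : D.PositiveGains) (i : Fin N) (y : LoopState N n m l p) :
    0 ≤ followerEnergy φ E S D i y := by
  obtain ⟨c, hc, h⟩ := exists_bound_of_followerEnergy_le (l := l) φ E hS hD i
  exact le_trans (by positivity) (h y)

theorem totalEnergy_nonneg (hS : ∀ i, (S i).Admissible)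
    (hGr : IsLeaderFollowingGraph Gr) (hD : D.PositiveGains) {a b : ℝ} (ha : 0 < a) (hb : 0 < b)
    (i : Fin N) (y : LoopState N n m l p) : 0 ≤ totalEnergy φ ω E Gr S D k a b i y := by
  have h1 := observerEnergy_nonneg (ω := ω) hGr hD.μ_pos k y
  have h2 := followerEnergy_nonneg φ E hS hD i y
  unfold totalEnergy
  positivity

/-- The velocity is recovered from the sliding variable, the position and the part of the reference
velocity that does not involve the position. -/
theorem exists_follower_bound (hφ : ContDiff ℝ 1 φ) (hS : ∀ i, (S i).Admissible)
    (hGr : IsLeaderFollowingGraph Gr) (hD : D.PositiveGains) (hρ : ∀ i, ContDiff ℝ 1 (D.ρ i))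
    (ω : Vec l) (E : Vec m →L[ℝ] Vec n) {a b : ℝ} (ha : 0 < a) (hb : 0 < b) (k R V U : ℝ)
    (i : Fin N) :
    ∃ B : ℝ, ∀ y : LoopState N n m l p, ‖y.v‖ ≤ R → observerEnergy ω Gr D.μ k y ≤ V →
      totalEnergy φ ω E Gr S D k a b i y ≤ U →
        ‖y.θh i‖ ≤ B ∧ ‖y.q i‖ ≤ B ∧ ‖y.dq i‖ ≤ B := by
  obtain ⟨B₀, hB₀, hobs⟩ := exists_observer_bound (p := p) hφ hGr hD hρ ω E k R V
  obtain ⟨c, hc, hW⟩ := exists_bound_of_followerEnergy_le (l := l) φ E hS hD i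
  set P := 1 + U / (b * c)
  set Q := 1 + U + ‖E‖ * B₀
  refine ⟨max (‖(S i).θ‖ + P) (max Q (P + (B₀ + D.α * Q))), fun y hv hV hU => ?_⟩
  obtain ⟨h1, -, -, -, h2⟩ := hobs y hv hV i
  have h3 : 0 ≤ a * observerEnergy ω Gr D.μ k y :=
    mul_nonneg ha.le (observerEnergy_nonneg hGr hD.μ_pos k y)
  have h4 : 0 ≤ b * followerEnergy φ E S D i y :=
    mul_nonneg hb.le (followerEnergy_nonneg φ E hS hD i y)
  have h5 := sq_nonneg ‖trackErr E y i‖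
  unfold totalEnergy at hU
  have hbW : c * ‖slidingVar φ E D y i‖ ^ 2 + c * ‖y.θh i - (S i).θ‖ ^ 2 ≤ U / b := by
    refine (hW y).trans ?_
    rw [le_div_iff₀ hb]
    linarith
  have hs : ‖slidingVar φ E D y i‖ ≤ P := le_one_add_of_sq_le (by
    rw [← div_div, le_div_iff₀ hc]
    linarith [mul_nonneg hc.le (sq_nonneg ‖y.θh i - (S i).θ‖)])
  have hθ : ‖y.θh i - (S i).θ‖ ≤ P := le_one_add_of_sq_le (by
    rw [← div_div, le_div_iff₀ hc]
    linarith [mul_nonneg hc.le (sq_nonneg ‖slidingVar φ E D y i‖)])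
  have he : ‖trackErr E y i‖ ≤ 1 + U := le_one_add_of_sq_le (by linarith)
  have hq : ‖y.q i‖ ≤ Q := by
    have h6 : y.q i = trackErr E y i + E (y.vh i) := by
      rw [trackErr]
      abel
    rw [h6]
    refine (norm_add_le _ _).trans (add_le_add he ((E.le_opNorm _).trans ?_))
    gcongr
  refine ⟨le_max_of_le_left ?_, le_max_of_le_right (le_max_of_le_left hq),
    le_max_of_le_right (le_max_of_le_right ?_)⟩
  · have := norm_le_norm_add_norm_sub' (y.θh i) (S i).θ
    linarith
  · have h6 : y.dq i = slidingVar φ E D y i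
        + ((refVel φ E D y i + D.α • y.q i) - D.α • y.q i) := by
      rw [slidingVar]
      abel
    rw [h6]
    refine (norm_add_le _ _).trans (add_le_add hs ((norm_sub_le _ _).trans (add_le_add h2 ?_)))
    rw [norm_smul, Real.norm_of_nonneg hD.α_pos.le]
    exact mul_le_mul_of_nonneg_left hq hD.α_pos.le

/-- All motions with the same initial state and a bounded leader stay in one bounded set. -/
theorem exists_bound_of_isBoundedLeaderRun (hφ : ContDiff ℝ 1 φ) (hS : ∀ i, (S i).Admissible)
    (hGr : IsLeaderFollowingGraph Gr) (hD : D.PositiveGains) (hρ : ∀ i, ContDiff ℝ 1 (D.ρ i))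
    (hρ1 : ∀ i z, 1 ≤ D.ρ i z) (hc : MismatchBound φ ω Gr D R c) (E : Vec m →L[ℝ] Vec n)
    (x₀ : LoopState N n m l p) :
    ∃ B : ℝ, ∀ J x, IsBoundedLeaderRun φ ω E Gr S D x₀ R J x → ∀ t ∈ J, ‖(x t).toVec‖ ≤ B := by
  obtain ⟨B₀, hB₀, hobs⟩ := exists_observer_bound (p := p) hφ hGr hD hρ ω E (c + 1) R
    (observerEnergy ω Gr D.μ (c + 1) x₀)
  choose a b ha hb hU using exists_totalEnergy hφ hS hGr hD hρ hρ1 hc E x₀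
  choose B hB using fun i => exists_follower_bound hφ hS hGr hD hρ ω E (ha i) (hb i) (c + 1) R
    (observerEnergy ω Gr D.μ (c + 1) x₀) (totalEnergy φ ω E Gr S D (c + 1) (a i) (b i) i x₀) i
  obtain ⟨B₁, hB₁⟩ := (finite_range B).bddAbove
  have hBi : ∀ i, B i ≤ B₁ := fun i => hB₁ (mem_range_self i)
  set B₂ := max (max R B₀) B₁
  refine ⟨B₂, fun J x r t ht => ?_⟩
  have h0 : 0 ≤ B₂ := le_max_of_le_left (le_max_of_le_right hB₀)
  have hV := r.observerEnergy_le hGr hD hρ1 hc ht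
  have hv := r.leader_le t ht
  have hle : B₀ ≤ B₂ := (le_max_right _ _).trans (le_max_left _ _)
  have hfol := fun i => hB i (x t) hv (hV i) (r.le_initial (fun s hs =>
    let ⟨w, hw, hw'⟩ := hU i J x r s hs
    ⟨w, hw, hw'.trans (neg_nonpos.2 (add_nonneg (sq_nonneg _)
      (mul_nonneg hD.α_pos.le (sq_nonneg _))))⟩) ht)
  have hle' : ∀ i, B i ≤ B₂ := fun i => (hBi i).trans (le_max_right _ _)
  simp only [LoopState.toVec, Prod.norm_def, sup_le_iff, pi_norm_le_iff_of_nonneg h0]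
  exact ⟨hv.trans ((le_max_left _ _).trans (le_max_left _ _)),
    fun i => (hobs _ hv (hV i) i).1.trans hle, fun i => (hobs _ hv (hV i) i).2.1.trans hle,
    fun i => (hobs _ hv (hV i) i).2.2.1.trans hle, fun i => (hfol i).1.trans (hle' i),
    fun i => (hfol i).2.1.trans (hle' i), fun i => (hfol i).2.2.trans (hle' i)⟩

end Boundedness

/-! ### Convergence -/

section Convergence

variable {N n m l p : ℕ} {φ : Vec m → Vec l →L[ℝ] Vec m} {ω : Vec l} {E : Vec m →L[ℝ] Vec n}
  {Gr : Digraph (Option (Fin N))} {S : Fin N → ELSystem n p} {D : Design N n m p}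
  {x : ℝ → LoopState N n m l p} {x₀ : LoopState N n m l p} {R c : ℝ}

theorem uniformContinuousOn_of_bounded_motion {V : Type*} [NormedAddCommGroup V] [NormedSpace ℝ V]
    [FiniteDimensional ℝ V] {F : V → V} (hF : Continuous F) {y : ℝ → V} {B : ℝ}
    (hy : ∀ t ∈ Ici (0 : ℝ), HasDerivWithinAt y (F (y t)) (Ici 0) t)
    (hB : ∀ t ∈ Ici (0 : ℝ), ‖y t‖ ≤ B) {f : V → ℝ} (hf : Continuous f) :
    UniformContinuousOn (fun t => f (y t)) (Ici 0) := by
  have hmem : MapsTo y (Ici 0) (Metric.closedBall 0 B) :=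
    fun t ht => mem_closedBall_zero_iff.2 (hB t ht)
  obtain ⟨L, hL⟩ := (isCompact_closedBall (0 : V) B).exists_bound_of_continuousOn hF.continuousOn
  have hlip : LipschitzOnWith L.toNNReal y (Ici 0) :=
    (convex_Ici 0).lipschitzOnWith_of_nnnorm_hasDerivWithin_le hy fun t ht => by
      rw [← NNReal.coe_le_coe, coe_nnnorm]
      exact (hL _ (hmem ht)).trans (Real.le_coe_toNNReal L)
  exact ((isCompact_closedBall (0 : V) B).uniformContinuousOn_of_continuous
    hf.continuousOn).comp hlip.uniformContinuousOn hmem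

theorem tendsto_zero_of_isBoundedLeaderRun (hφ : ContDiff ℝ 2 φ) (hS : ∀ i, (S i).Admissible)
    (hGr : IsLeaderFollowingGraph Gr) (hD : D.PositiveGains) (hρ : ∀ i, ContDiff ℝ 1 (D.ρ i))
    (hρ1 : ∀ i z, 1 ≤ D.ρ i z) (hc : MismatchBound φ ω Gr D R c)
    (r : IsBoundedLeaderRun φ ω E Gr S D x₀ R (Ici 0) x) (i : Fin N) :
    Tendsto (fun t => (x t).z Gr i) atTop (𝓝 0) ∧
      Tendsto (fun t => trackErr E (x t) i) atTop (𝓝 0) := by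
  have hφ1 : ContDiff ℝ 1 φ := hφ.of_le (by norm_num)
  obtain ⟨a, b, ha, hb, hU⟩ := exists_totalEnergy hφ1 hS hGr hD hρ hρ1 hc E x₀ i
  choose! w hw hw' using hU (Ici 0) x r
  obtain ⟨B, hB⟩ := exists_bound_of_isBoundedLeaderRun hφ1 hS hGr hD hρ hρ1 hc E x₀
  have hα := hD.α_pos
  have hf : Continuous fun y : ClosedLoopSpace N n m l p =>
      ‖(LoopState.ofVec y).z Gr i‖ ^ 2 + D.α * ‖trackErr E (LoopState.ofVec y) i‖ ^ 2 := by
    have h1 := (contDiff_localError (n := n) (m := m) (l := l) (p := p) (Gr := Gr) i).continuous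
    have h2 : Continuous fun y : ClosedLoopSpace N n m l p =>
        trackErr E (LoopState.ofVec y) i := by
      simp only [trackErr, LoopState.ofVec]
      fun_prop
    exact (h1.norm.pow 2).add ((h2.norm.pow 2).const_mul D.α)
  have hlim := tendsto_zero_of_dissipation hw hw'
    (fun t _ => totalEnergy_nonneg hS hGr hD ha hb i (x t)) (fun t _ => by positivity)
    (uniformContinuousOn_of_bounded_motion (y := fun t => (x t).toVec)
      (contDiff_loopField (ω := ω) hS hφ hρ).continuous r.follows (hB (Ici 0) x r) hf)
  have hsq : ∀ {W : Type} [NormedAddCommGroup W] (u : ℝ → W),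
      Tendsto (fun t => ‖u t‖ ^ 2) atTop (𝓝 0) → Tendsto u atTop (𝓝 0) := fun u hu => by
    rw [tendsto_zero_iff_norm_tendsto_zero]
    simpa using hu.sqrt
  refine ⟨hsq _ (squeeze_zero (fun t => sq_nonneg _) (fun t => ?_) hlim), hsq _ ?_⟩
  · exact le_add_of_nonneg_right (by positivity)
  · have h1 : Tendsto (fun t => D.α * ‖trackErr E (x t) i‖ ^ 2) atTop (𝓝 0) :=
      squeeze_zero (fun t => by positivity)
        (fun t => le_add_of_nonneg_left (sq_nonneg _)) hlim
    simpa [hα.ne'] using h1.const_mul D.α⁻¹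

/-- The leader of the closed loop coincides with the bounded motion granted by the assumption on
the leader, since solutions are unique. -/
theorem LeaderAssumption.exists_bound (hω : LeaderAssumption φ ω) (hφ : ContDiff ℝ 1 φ)
    {V₀ : Set (Vec m)} (hV₀ : IsCompact V₀) (hx₀ : x₀.v ∈ V₀) :
    ∃ R : ℝ, ∀ J x, FollowsLoop φ ω E Gr S D J x → Convex ℝ J → (0 : ℝ) ∈ J → J ⊆ Ici 0 →
      x 0 = x₀ → IsBoundedLeaderRun φ ω E Gr S D x₀ R J x := by
  obtain ⟨V₁, hV₁, hex⟩ := hω.bounded V₀ hV₀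
  obtain ⟨u, hu0, hu⟩ := hex x₀.v hx₀
  obtain ⟨R, hR⟩ := hV₁.isBounded.exists_norm_le
  refine ⟨R, fun J x h hJ h0 hsub hx => ⟨h, hJ, h0, hsub, hx, fun t ht => ?_⟩⟩
  have hsubJ : Icc 0 t ⊆ J := hJ.ordConnected.out h0 ht
  have hEq : EqOn (fun r => (x r).v) u (Icc 0 t) := eqOn_Icc_of_hasDerivWithinAt
    (F := fun v => φ v ω) (hφ.clm_apply contDiff_const)
    (fun s hs => (h.leader (hsubJ hs)).mono hsubJ)
    (fun s hs => (hu s hs.1).1.mono Icc_subset_Ici_self) (by rw [hx, hu0])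
  have h1 := hEq (right_mem_Icc.2 (hsub ht))
  simp only at h1
  rw [h1]
  exact hR _ (hu t (hsub ht)).2

end Convergence

end

theorem mainTheorem2 {N n m l p : ℕ} (φ : Vec m → Vec l →L[ℝ] Vec m) (hφ : ContDiff ℝ 2 φ)
    (E : Vec m →L[ℝ] Vec n) :
    ∃ ρ : Fin N → Vec m → ℝ, (∀ i, ContDiff ℝ ((⊤ : ℕ∞) : WithTop ℕ∞) (ρ i)) ∧ (∀ i z, 1 ≤ ρ i z) ∧
      ∀ ω : Vec l, LeaderAssumption φ ω →
      ∀ Gr : Digraph (Option (Fin N)), IsLeaderFollowingGraph Gr →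
      ∀ S : Fin N → ELSystem n p, (∀ i, (S i).Admissible) →
      ∀ D : Design N n m p, D.ρ = ρ → D.PositiveGains →
      ∀ V₀ : Set (Vec m), IsCompact V₀ → 0 ∈ V₀ →
      ∀ x₀ : LoopState N n m l p, x₀.v ∈ V₀ →
        (∃ x : ℝ → LoopState N n m l p, IsClosedLoopSolution φ ω E Gr S D x ∧ x 0 = x₀) ∧
        ∀ x : ℝ → LoopState N n m l p, IsClosedLoopSolution φ ω E Gr S D x → x 0 = x₀ →
          ∀ i : Fin N,
            (∃ B : ℝ, ∀ t, 0 ≤ t → ‖(x t).q i‖ ≤ B ∧ ‖(x t).dq i‖ ≤ B) ∧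
            Tendsto (fun t => (x t).q i - E (x t).v) atTop (𝓝 0) := by
  have hφ1 : ContDiff ℝ 1 φ := hφ.of_le (by norm_num)
  obtain ⟨g, hg, hg1, hgφ⟩ := exists_monotone_lipschitz_bound hφ1
  obtain ⟨C, hC, hgraph⟩ := exists_uniform_norm_le_mul_norm_localError N m
  -- The constants `g` and `C` depend on `φ`, `N` and `m` only, hence so does `ρ`.
  obtain ⟨ρ, hρ, hgρ⟩ := exists_smooth_majorant (V := Vec m) (h := fun r => g (2 * (C * r)))
    fun a b hab => hg (by gcongr)
  refine ⟨fun _ => ρ, fun _ => hρ, fun _ z => (hg1 _).trans (hgρ z), ?_⟩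
  intro ω hω Gr hGr S hS D hDρ hD V₀ hV₀ _ x₀ hx₀
  have hρD : ∀ i z, g (2 * (C * ‖z‖)) ≤ D.ρ i z := fun i z => by
    rw [hDρ]
    exact hgρ z
  have hρ1 : ∀ i z, 1 ≤ D.ρ i z := fun i z => (hg1 _).trans (hρD i z)
  have hρC : ∀ i, ContDiff ℝ 1 (D.ρ i) := fun i => by
    rw [hDρ]
    exact hρ.of_le (by exact_mod_cast le_top)
  obtain ⟨R, hR⟩ := hω.exists_bound (E := E) (Gr := Gr) (S := S) (D := D) hφ1 hV₀ hx₀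
  have hc : MismatchBound φ ω Gr D R (N * (g (2 * R) * C * ‖ω‖)) := fun v vh hv =>
    sum_inner_mismatch_le hg1 hgφ hC (hgraph Gr hGr) hρD
      (⟨v, vh, 0, 0, 0, 0, 0⟩ : LoopState N n m l p) hv
  obtain ⟨B, hB⟩ := exists_bound_of_isBoundedLeaderRun hφ1 hS hGr hD hρC hρ1 hc E x₀
  refine ⟨?_, fun x hx hx0 i => ?_⟩
  · obtain ⟨y, hy0, hy⟩ := exists_global_solution (contDiff_loopField (ω := ω) hS hφ hρC)
      x₀.toVec B fun T hT y hy0 hy => hB (Icc 0 T) (fun t => LoopState.ofVec (y t))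
        (hR _ _ hy (convex_Icc _ _) (left_mem_Icc.2 hT) Icc_subset_Ici_self (by rw [hy0]; rfl))
    have hfol : FollowsLoop φ ω E Gr S D (Ici 0) fun t => LoopState.ofVec (y t) := hy
    exact ⟨_, hfol.isClosedLoopSolution hS, by rw [hy0]; rfl⟩
  · have r := hR _ x (hx.followsLoop hS) (convex_Ici 0) self_mem_Ici Subset.rfl hx0
    constructor
    · refine ⟨B, fun t ht => ?_⟩
      have h1 := hB _ x r t ht
      have hB0 : 0 ≤ B := (norm_nonneg _).trans h1
      simp only [LoopState.toVec, Prod.norm_def, sup_le_iff, pi_norm_le_iff_of_nonneg hB0] at h1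
      exact ⟨h1.2.2.2.2.2.1 i, h1.2.2.2.2.2.2 i⟩
    · have hlim := tendsto_zero_of_isBoundedLeaderRun hφ hS hGr hD hρC hρ1 hc r
      have hz : Tendsto (fun t => (x t).z Gr) atTop (𝓝 0) := tendsto_pi_nhds.2 fun j => (hlim j).1
      have hv : Tendsto (fun t => (x t).vh i - (x t).v) atTop (𝓝 0) := by
        refine squeeze_zero_norm (a := fun t => C * ‖(x t).z Gr‖) (fun t => ?_) (by
          simpa using hz.norm.const_mul C)
        have h1 := hgraph Gr hGr fun j => (x t).vh j - (x t).v
        rw [← localError_eq_sub] at h1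
        exact (norm_le_pi_norm (fun j => (x t).vh j - (x t).v) i).trans h1
      have h2 := (hlim i).2.add ((E.continuous.tendsto 0).comp hv)
      rw [map_zero, add_zero] at h2
      refine h2.congr fun t => ?_
      simp only [trackErr, Function.comp_apply, map_sub]
      abel
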